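/- **Theorem 3.5.** Let $R$ be an associative unital ring and $M$ an $R$-bimodule. Put $M^{\otimes_R 0}=R$, $M^{\otimes_R(i+1)}=M\otimes_R M^{\otimes_R i}$, and suppose that $M$ is $N$-nilpotent for some integer $N\ge 0$, i.e. $M^{\otimes_R(N+1)}=0$. Let $T=T_R(M)=\bigoplus_{i=0}^{N}M^{\otimes_R i}$ be the tensor ring. Right modules over a ring $S$ are called $S^{op}$-modules. A $T^{op}$-module is viewed as a pair $[Y,v]$, where $Y$ is its underlying $R^{op}$-module and $v\colon Y\to \operatorname{Hom}_{R^{op}}(M,Y)$ is the $R^{op}$-homomorphism $v(y)(m)=ym$; for an $R$-bimodule $P$, $\operatorname{Hom}_{R^{op}}(P,Y)$ is an $R^{op}$-module via $(f\cdot r)(p)=f(rp)$. Let $U$ be the forgetful functor from $T^{op}$-modules to $R^{op}$-modules and let $\mathrm{Coind}=\operatorname{Hom}_{R^{op}}(T,-)$ be its right adjoint. For a ring $S$ and a class $\mathcal Z$ of $S^{op}$-modules, a *$\mathcal Z$-complete injective resolution* is an exact complex $I^\bullet=(\cdots\to I^{-1}\to I^0\to I^1\to\cdots)$ of injective $S^{op}$-modules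 such that $\operatorname{Hom}_{S^{op}}(Z,I^\bullet)$ is exact for every $Z\in\mathcal Z$. An $S^{op}$-module $H$ is *$\mathcal Z$-Gorenstein injective* if $H\cong\ker(I^0\to I^1)$ for some $\mathcal Z$-complete injective resolution $I^\bullet$; the class of these modules is denoted $\mathcal Z\text{-}\mathsf{GI}(S^{op})$. Let $\mathcal Y$ be a class of $R^{op}$-modules that contains all injective $R^{op}$-modules, and let $\mathrm{Coind}(\mathcal Y)$ be the class of $T^{op}$-modules isomorphic to $\mathrm{Coind}(Y)$ for some $Y\in\mathcal Y$. Assume: * ($M$ is co-compatible with respect to $\mathcal Y$) for every $\mathrm{Coind}(\mathcal Y)$-complete injective resolution $I^\bullet$ of $T^{op}$-modules, the complex $\operatorname{Hom}_{R^{op}}(M,U(I^\bullet))$ is exact, and the complex $\operatorname{Hom}_{T^{op}}(\mathrm{Coind}(\operatorname{Hom}_{R^{op}}(M,Y)),I^\bullet)$ is exact for each $Y\in\mathcal Y$; * ($M$ is co-admissible with respect to $\mathcal Y$) for all $H\in\mathcal Y\text{-}\mathsf{GI}(R^{op})$, $Y\in\mathcal Y$ and $i\ge 0$, $$\operatorname{Ext}^1_{R^{op}}(\operatorname{Hom}_{R^{op}}(M^{\otimes_R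 i},Y),H)=0=\operatorname{Ext}^1_{R^{op}}(M,\operatorname{Hom}_{R^{op}}(M^{\otimes_R i},H)).$$ Then a $T^{op}$-module $[Y,v]$ is $\mathrm{Coind}(\mathcal Y)$-Gorenstein injective if and only if $v$ is surjective and $\ker v$ is a $\mathcal Y$-Gorenstein injective $R^{op}$-module. In other words, $$\mathrm{Coind}(\mathcal Y)\text{-}\mathsf{GI}(T_R(M)^{op})=\Psi\bigl(\mathcal Y\text{-}\mathsf{GI}(R^{op})\bigr),$$ where, for a class $\mathcal Z$ of $R^{op}$-modules, $\Psi(\mathcal Z)$ is the class of $T^{op}$-modules $[Y,v]$ with $v$ surjective and $\ker v\in\mathcal Z$. -/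

import Mathlib

open CategoryTheory CategoryTheory.Limits MulOpposite
open scoped TensorProduct DirectSum

universe u

/-! ## Tensor products over a (not necessarily commutative) ring

A right `R`-module is a module over `Rᵐᵒᵖ`; `op r • a` is `a · r`. -/

namespace BalancedTensor

section

variable (R : Type u) [Ring R] (A B : Type u) [AddCommGroup A] [Module Rᵐᵒᵖ A]
  [AddCommGroup B] [Module R B]

/-- The relations `(a · r) ⊗ b = a ⊗ (r · b)` in `A ⊗_ℤ B`. -/
def rel : Submodule ℤ (A ⊗[ℤ] B) :=
  Submodule.span ℤ
    {t | ∃ (a : A) (r : R) (b : B), t = (op r • a) ⊗ₜ[ℤ] b - a ⊗ₜ[ℤ] (r • b)}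

end

end BalancedTensor

/-- The tensor product `A ⊗_R B` of a right `R`-module `A` and a left `R`-module `B`. -/
def BalancedTensor (R : Type u) [Ring R] (A B : Type u) [AddCommGroup A] [Module Rᵐᵒᵖ A]
    [AddCommGroup B] [Module R B] : Type u :=
  (A ⊗[ℤ] B) ⧸ BalancedTensor.rel R A B

namespace BalancedTensor

section

variable {R : Type u} [Ring R] {A B : Type u} [AddCommGroup A] [Module Rᵐᵒᵖ A]
  [AddCommGroup B] [Module R B]

instance : AddCommGroup (BalancedTensor R A B) :=
  inferInstanceAs (AddCommGroup ((A ⊗[ℤ] B) ⧸ BalancedTensor.rel R A B))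

variable (R) in
/-- The pure tensor `a ⊗ b`. -/
def tmul (a : A) (b : B) : BalancedTensor R A B :=
  (rel R A B).mkQ (a ⊗ₜ[ℤ] b)

theorem add_tmul (a a' : A) (b : B) : tmul R (a + a') b = tmul R a b + tmul R a' b := by
  simp only [tmul, TensorProduct.add_tmul, map_add]; rfl

theorem tmul_add (a : A) (b b' : B) : tmul R a (b + b') = tmul R a b + tmul R a b' := by
  simp only [tmul, TensorProduct.tmul_add, map_add]; rfl

theorem smul_tmul (a : A) (r : R) (b : B) : tmul R (op r • a) b = tmul R a (r • b) := by
  refine (Submodule.Quotient.eq _).2 (Submodule.subset_span ⟨a, r, b, rfl⟩)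

/-- The additive map out of `A ⊗_R B` given by a balanced biadditive map. -/
def lift {C : Type*} [AddCommGroup C] (f : A →+ B →+ C)
    (hf : ∀ a (r : R) b, f (op r • a) b = f a (r • b)) : BalancedTensor R A B →+ C :=
  ((rel R A B).liftQ
    (TensorProduct.liftAddHom f (fun n a b => by simp)).toIntLinearMap
    (by
      refine Submodule.span_le.2 ?_
      rintro _ ⟨a, r, b, rfl⟩
      simp [hf a r b])).toAddMonoidHom

@[simp]
theorem lift_tmul {C : Type*} [AddCommGroup C] (f : A →+ B →+ C)
    (hf : ∀ a (r : R) b, f (op r • a) b = f a (r • b)) (a : A) (b : B) :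
    lift f hf (tmul R a b) = f a b := by
  change (TensorProduct.liftAddHom f (fun n a b => by simp)) (a ⊗ₜ[ℤ] b) = f a b
  simp

theorem hom_ext {C : Type*} [AddCommGroup C] {f g : BalancedTensor R A B →+ C}
    (h : ∀ a b, f (tmul R a b) = g (tmul R a b)) : f = g := by
  ext x
  obtain ⟨t, rfl⟩ := Submodule.Quotient.mk_surjective _ x
  induction t using TensorProduct.induction_on with
  | zero => exact (map_zero f).trans (map_zero g).symm
  | tmul a b => exact h a b
  | add s t hs ht => exact (map_add f _ _).trans ((congrArg₂ _ hs ht).trans (map_add g _ _).symm)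

/-- `(a, b) ↦ a ⊗ b` as a biadditive map. -/
def tmulHom : A →+ B →+ BalancedTensor R A B :=
  AddMonoidHom.mk' (fun a => AddMonoidHom.mk' (tmul R a) (tmul_add a))
    (fun a a' => by ext b; exact add_tmul a a' b)

@[simp]
theorem tmulHom_apply (a : A) (b : B) : tmulHom (R := R) a b = tmul R a b := rfl

end

section left

variable {R : Type u} [Ring R] {A B : Type u} [AddCommGroup A] [Module R A] [Module Rᵐᵒᵖ A]
  [SMulCommClass R Rᵐᵒᵖ A] [AddCommGroup B] [Module R B]

/-- The left action `s · (a ⊗ b) = (s · a) ⊗ b`. -/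
def leftMul (s : R) : BalancedTensor R A B →+ BalancedTensor R A B :=
  lift (tmulHom.comp (DistribSMul.toAddMonoidHom A s))
    (fun a r b => by simp [smul_comm s (op r) a, smul_tmul])

@[simp]
theorem leftMul_tmul (s : R) (a : A) (b : B) : leftMul s (tmul R a b) = tmul R (s • a) b :=
  lift_tmul _ _ a b

instance leftModule : Module R (BalancedTensor R A B) where
  smul s x := leftMul s x
  one_smul x := DFunLike.congr_fun
    (hom_ext (f := leftMul 1) (g := AddMonoidHom.id _) fun a b => by simp) x
  mul_smul s t x := DFunLike.congr_fun
    (hom_ext (f := leftMul (s * t)) (g := (leftMul s).comp (leftMul t))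
      fun a b => by simp [mul_smul]) x
  smul_zero s := map_zero (leftMul s)
  smul_add s := map_add (leftMul s)
  add_smul s t x := DFunLike.congr_fun
    (hom_ext (f := leftMul (s + t)) (g := leftMul s + leftMul t)
      fun a b => by simp [add_smul, add_tmul]) x
  zero_smul x := DFunLike.congr_fun
    (hom_ext (f := leftMul 0) (g := 0)
      fun a b => by
        rw [leftMul_tmul, zero_smul, ← tmulHom_apply, map_zero]; rfl) x

theorem left_smul_tmul (s : R) (a : A) (b : B) : s • tmul R a b = tmul R (s • a) b :=
  leftMul_tmul s a b

end left

section right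

variable {R : Type u} [Ring R] {A B : Type u} [AddCommGroup A] [Module Rᵐᵒᵖ A]
  [AddCommGroup B] [Module R B] [Module Rᵐᵒᵖ B] [SMulCommClass R Rᵐᵒᵖ B]

/-- The right action `(a ⊗ b) · s = a ⊗ (b · s)`. -/
def rightMul (s : Rᵐᵒᵖ) : BalancedTensor R A B →+ BalancedTensor R A B :=
  lift (tmulHom.compl₂ (DistribSMul.toAddMonoidHom B s))
    (fun a r b => by simp [smul_tmul, smul_comm r s b])

@[simp]
theorem rightMul_tmul (s : Rᵐᵒᵖ) (a : A) (b : B) : rightMul s (tmul R a b) = tmul R a (s • b) :=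
  lift_tmul _ _ a b

instance rightModule : Module Rᵐᵒᵖ (BalancedTensor R A B) where
  smul s x := rightMul s x
  one_smul x := DFunLike.congr_fun
    (hom_ext (f := rightMul 1) (g := AddMonoidHom.id _) fun a b => by simp) x
  mul_smul s t x := DFunLike.congr_fun
    (hom_ext (f := rightMul (s * t)) (g := (rightMul s).comp (rightMul t))
      fun a b => by simp [mul_smul]) x
  smul_zero s := map_zero (rightMul s)
  smul_add s := map_add (rightMul s)
  add_smul s t x := DFunLike.congr_fun
    (hom_ext (f := rightMul (s + t)) (g := rightMul s + rightMul t)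
      fun a b => by simp [add_smul, tmul_add]) x
  zero_smul x := DFunLike.congr_fun
    (hom_ext (f := rightMul 0) (g := 0)
      fun a b => by simpa using map_zero (tmulHom (R := R) a)) x

theorem right_smul_tmul (s : Rᵐᵒᵖ) (a : A) (b : B) : s • tmul R a b = tmul R a (s • b) :=
  rightMul_tmul s a b

end right

section both

variable {R : Type u} [Ring R] {A B : Type u} [AddCommGroup A] [Module R A] [Module Rᵐᵒᵖ A]
  [SMulCommClass R Rᵐᵒᵖ A] [AddCommGroup B] [Module R B] [Module Rᵐᵒᵖ B]
  [SMulCommClass R Rᵐᵒᵖ B]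

instance smulCommClass : SMulCommClass R Rᵐᵒᵖ (BalancedTensor R A B) where
  smul_comm s t x := DFunLike.congr_fun
    (hom_ext (f := (leftMul s).comp (rightMul t)) (g := (rightMul t).comp (leftMul s))
      fun a b => by simp) x

end both

end BalancedTensor

/-! ## Bimodules and tensor rings -/

/-- An `R`-bimodule (`R`-`R`-bimodule). -/
structure RingBimodule (R : Type u) [Ring R] where
  carrier : Type u
  [addCommGroup : AddCommGroup carrier]
  [leftModule : Module R carrier]
  [rightModule : Module Rᵐᵒᵖ carrier]
  [smulCommClass : SMulCommClass R Rᵐᵒᵖ carrier]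

namespace RingBimodule

attribute [instance] addCommGroup leftModule rightModule smulCommClass

section

variable {R : Type u} [Ring R]

/-- `M^{⊗ 0} = R` and `M^{⊗ (i+1)} = M ⊗_R M^{⊗ i}`. -/
def pow (M : RingBimodule R) : ℕ → RingBimodule R
  | 0 => ⟨R⟩
  | i + 1 => ⟨BalancedTensor R M.carrier (pow M i).carrier⟩

/-- `M` is `N`-nilpotent if `M^{⊗ (N+1)} = 0`. -/
def IsNilpotentOf (M : RingBimodule R) (N : ℕ) : Prop :=
  Subsingleton (M.pow (N + 1)).carrier

/-- The underlying right `R`-module. -/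
abbrev toRight (M : RingBimodule R) : ModuleCat.{u} Rᵐᵒᵖ := ModuleCat.of Rᵐᵒᵖ M.carrier

/-- The underlying group `⨁ i, M^{⊗ i}` of the tensor ring `T_R(M)`. If `M` is `N`-nilpotent,
the summands with `i > N` vanish and this is `⨁_{i=0}^N M^{⊗ i}`. -/
def TensorRing (M : RingBimodule R) : Type u := ⨁ i, (M.pow i).carrier

namespace TensorRing

variable {M : RingBimodule R}

instance : AddCommGroup M.TensorRing :=
  inferInstanceAs (AddCommGroup (⨁ i, (M.pow i).carrier))

/-- The left `R`-module structure of `⨁ i, M^{⊗ i}`. -/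
instance : Module R M.TensorRing :=
  inferInstanceAs (Module R (⨁ i, (M.pow i).carrier))

/-- The inclusion of the summand `M^{⊗ i}`. -/
def of (i : ℕ) : (M.pow i).carrier →ₗ[R] M.TensorRing :=
  DirectSum.lof R ℕ (fun i => (M.pow i).carrier) i

theorem hom_ext {C : Type*} [AddCommGroup C] {f g : M.TensorRing →+ C}
    (h : ∀ i x, f (of i x) = g (of i x)) : f = g :=
  DirectSum.addHom_ext h

/-- `(a, x) ↦ a ⊗ x` from `M × M^{⊗ i}` to `M^{⊗ (i+1)}`. -/
def cons (i : ℕ) : M.carrier →+ (M.pow i).carrier →+ (M.pow (i + 1)).carrier :=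
  BalancedTensor.tmulHom (R := R)

theorem cons_smul_left (i : ℕ) (r : R) (a : M.carrier) (x : (M.pow i).carrier) :
    cons i (r • a) x = r • cons i a x :=
  (BalancedTensor.left_smul_tmul r a x).symm

theorem cons_smul_middle (i : ℕ) (r : R) (a : M.carrier) (x : (M.pow i).carrier) :
    cons i (op r • a) x = cons i a (r • x) :=
  BalancedTensor.smul_tmul a r x

theorem cons_smul_right (i : ℕ) (s : Rᵐᵒᵖ) (a : M.carrier) (x : (M.pow i).carrier) :
    cons i a (s • x) = s • cons i a x :=
  (BalancedTensor.right_smul_tmul s a x).symm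

theorem pow_succ_hom_ext {i : ℕ} {C : Type*} [AddCommGroup C]
    {f g : (M.pow (i + 1)).carrier →+ C} (h : ∀ a x, f (cons i a x) = g (cons i a x)) : f = g :=
  BalancedTensor.hom_ext h

/-- `a ⊗ -`, sending `x ∈ M^{⊗ i}` to `a ⊗ x ∈ M^{⊗ (i+1)}`. -/
def shift (a : M.carrier) : M.TensorRing →+ M.TensorRing :=
  DirectSum.toAddMonoid fun i => (of (M := M) (i + 1)).toAddMonoidHom.comp (cons i a)

theorem shift_of (a : M.carrier) (i : ℕ) (x : (M.pow i).carrier) :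
    shift a (of i x) = of (i + 1) (cons i a x) :=
  DirectSum.toAddMonoid_of _ _ _

theorem shift_add (a b : M.carrier) : shift (a + b) = shift a + shift b :=
  hom_ext fun i x => by
    rw [AddMonoidHom.add_apply, shift_of, shift_of, shift_of, map_add,
      AddMonoidHom.add_apply, map_add]

theorem shift_smul_left (r : R) (a : M.carrier) (x : M.TensorRing) :
    shift (r • a) x = r • shift a x :=
  DFunLike.congr_fun (hom_ext (f := shift (r • a))
    (g := (DistribSMul.toAddMonoidHom _ r).comp (shift a)) fun i x => by
      change shift (r • a) (of i x) = r • shift a (of i x)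
      rw [shift_of, shift_of, cons_smul_left, map_smul]) x

theorem shift_smul_right (r : R) (a : M.carrier) (x : M.TensorRing) :
    shift (op r • a) x = shift a (r • x) :=
  DFunLike.congr_fun (hom_ext (f := shift (op r • a))
    (g := (shift a).comp (DistribSMul.toAddMonoidHom _ r)) fun i x => by
      change shift (op r • a) (of i x) = shift a (r • of i x)
      rw [← map_smul, shift_of, shift_of, cons_smul_middle]) x

/-- The action of `R = M^{⊗ 0}` by scalars. -/
def mulZero : R →ₗ[R] (M.TensorRing →+ M.TensorRing) where
  toFun r := DistribSMul.toAddMonoidHom M.TensorRing r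
  map_add' r s := AddMonoidHom.ext fun y => add_smul r s y
  map_smul' r s := AddMonoidHom.ext fun y => mul_smul r s y

/-- `a ⊗ x ↦ (a ⊗ -) ∘ f x`, for `f` an action of `M^{⊗ i}`. -/
def mulSuccAdd (i : ℕ) (f : (M.pow i).carrier →ₗ[R] (M.TensorRing →+ M.TensorRing)) :
    (M.pow (i + 1)).carrier →+ (M.TensorRing →+ M.TensorRing) :=
  BalancedTensor.lift (R := R) (A := M.carrier) (B := (M.pow i).carrier)
    (AddMonoidHom.mk'
      (fun a => AddMonoidHom.mk' (fun x => (shift a).comp (f x))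
        (fun x x' => AddMonoidHom.ext fun y => by simp))
      (fun a a' => AddMonoidHom.ext fun x => AddMonoidHom.ext fun y => by
        simp [shift_add]))
    (fun a r x => AddMonoidHom.ext fun y => by simp [shift_smul_right])

theorem mulSuccAdd_cons (i : ℕ) (f : (M.pow i).carrier →ₗ[R] (M.TensorRing →+ M.TensorRing))
    (a : M.carrier) (x : (M.pow i).carrier) (y : M.TensorRing) :
    mulSuccAdd i f (cons i a x) y = shift a (f x y) :=
  DFunLike.congr_fun (BalancedTensor.lift_tmul _ _ a x) y

/-- `mulSuccAdd` is left `R`-linear. -/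
def mulSucc (i : ℕ) (f : (M.pow i).carrier →ₗ[R] (M.TensorRing →+ M.TensorRing)) :
    (M.pow (i + 1)).carrier →ₗ[R] (M.TensorRing →+ M.TensorRing) where
  toFun := mulSuccAdd i f
  map_add' := map_add _
  map_smul' r x := DFunLike.congr_fun
    (pow_succ_hom_ext
      (f := (mulSuccAdd i f).comp (DistribSMul.toAddMonoidHom _ r))
      (g := (DistribSMul.toAddMonoidHom _ r).comp (mulSuccAdd i f))
      fun a x => AddMonoidHom.ext fun y => by
        change mulSuccAdd i f (r • cons i a x) y = r • mulSuccAdd i f (cons i a x) y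
        rw [← cons_smul_left, mulSuccAdd_cons, mulSuccAdd_cons, shift_smul_left]) x

/-- Left multiplication by elements of `M^{⊗ i}`: `r * y = r · y` for `r ∈ R = M^{⊗ 0}` and
`(a ⊗ x) * y = a ⊗ (x * y)` for `a ∈ M`, `x ∈ M^{⊗ i}`. On homogeneous elements this is
concatenation of tensors. -/
def mulPow : (i : ℕ) → (M.pow i).carrier →ₗ[R] (M.TensorRing →+ M.TensorRing)
  | 0 => mulZero
  | i + 1 => mulSucc i (mulPow i)

theorem mulPow_zero (r : R) (y : M.TensorRing) : mulPow (M := M) 0 r y = r • y := rfl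

theorem mulPow_cons (i : ℕ) (a : M.carrier) (x : (M.pow i).carrier) (y : M.TensorRing) :
    mulPow (i + 1) (cons i a x) y = shift a (mulPow i x y) :=
  mulSuccAdd_cons i (mulPow i) a x y

/-- Multiplication of the tensor ring, as an `R`-linear map in the first variable. -/
def mulHom : M.TensorRing →ₗ[R] (M.TensorRing →+ M.TensorRing) :=
  DirectSum.toModule R ℕ _ mulPow

theorem mulHom_of (i : ℕ) (x : (M.pow i).carrier) : mulHom (of i x) = mulPow i x :=
  DirectSum.toModule_lof R _ _

theorem mulHom_shift (a : M.carrier) (x y : M.TensorRing) :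
    mulHom (shift a x) y = shift a (mulHom x y) :=
  DFunLike.congr_fun (DFunLike.congr_fun
    (hom_ext (f := mulHom.toAddMonoidHom.comp (shift a))
      (g := (AddMonoidHom.compHom (shift a)).comp mulHom.toAddMonoidHom)
      fun i x => AddMonoidHom.ext fun y => by
        change mulHom (shift a (of i x)) y = shift a (mulHom (of i x) y)
        rw [shift_of, mulHom_of, mulHom_of, mulPow_cons]) x) y

/-- The inclusion of the summand `R = M^{⊗ 0}`, as a left `R`-linear map. -/
def ofScalar : R →ₗ[R] M.TensorRing := of (M := M) 0

theorem mulHom_ofScalar (r : R) (y : M.TensorRing) : mulHom (ofScalar r) y = r • y :=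
  DFunLike.congr_fun (mulHom_of (M := M) 0 r) y

/-- The unit `1 ∈ R = M^{⊗ 0}`. -/
def unit : M.TensorRing := ofScalar 1

theorem mulHom_unit (y : M.TensorRing) : mulHom unit y = y := by
  rw [unit, mulHom_ofScalar, one_smul]

theorem smul_unit (r : R) : r • (unit : M.TensorRing) = ofScalar r := by
  rw [unit, ← map_smul, smul_eq_mul, mul_one]

theorem mulPow_unit (i : ℕ) (x : (M.pow i).carrier) : mulPow i x unit = of i x := by
  induction i with
  | zero => exact smul_unit (M := M) x
  | succ i ih =>
    exact DFunLike.congr_fun (pow_succ_hom_ext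
      (f := (AddMonoidHom.eval unit).comp (mulPow (M := M) (i + 1)).toAddMonoidHom)
      (g := (of (M := M) (i + 1)).toAddMonoidHom) fun a x => by
        change mulPow (i + 1) (cons i a x) unit = of (i + 1) (cons i a x)
        rw [mulPow_cons, ih, shift_of]) x

theorem mulPow_assoc (i : ℕ) (x : (M.pow i).carrier) (y z : M.TensorRing) :
    mulHom (mulPow i x y) z = mulPow i x (mulHom y z) := by
  induction i with
  | zero => exact DFunLike.congr_fun (LinearMap.map_smul (mulHom (M := M)) (show R from x) y) z
  | succ i ih =>
    exact DFunLike.congr_fun (pow_succ_hom_ext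
      (f := (AddMonoidHom.eval z).comp (mulHom.toAddMonoidHom.comp
        ((AddMonoidHom.eval y).comp (mulPow (M := M) (i + 1)).toAddMonoidHom)))
      (g := (AddMonoidHom.eval (mulHom y z)).comp (mulPow (M := M) (i + 1)).toAddMonoidHom)
      fun a x => by
        change mulHom (mulPow (i + 1) (cons i a x) y) z =
          mulPow (i + 1) (cons i a x) (mulHom y z)
        rw [mulPow_cons, mulPow_cons, mulHom_shift, ih]) x

theorem mulHom_assoc (x y z : M.TensorRing) :
    mulHom (mulHom x y) z = mulHom x (mulHom y z) :=
  DFunLike.congr_fun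
    (hom_ext
      (f := (AddMonoidHom.eval z).comp (mulHom.toAddMonoidHom.comp
        ((AddMonoidHom.eval y).comp mulHom.toAddMonoidHom)))
      (g := (AddMonoidHom.eval (mulHom y z)).comp mulHom.toAddMonoidHom)
      fun i x => by
        change mulHom (mulHom (of i x) y) z = mulHom (of i x) (mulHom y z)
        rw [mulHom_of, mulPow_assoc]) x

theorem mulHom_unit_right (x : M.TensorRing) : mulHom x unit = x :=
  DFunLike.congr_fun
    (hom_ext (f := (AddMonoidHom.eval unit).comp mulHom.toAddMonoidHom)
      (g := AddMonoidHom.id M.TensorRing)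
      fun i x => by
        change mulHom (of i x) unit = of i x
        rw [mulHom_of, mulPow_unit]) x

/-- The tensor ring `T_R(M)`. -/
instance : Ring M.TensorRing :=
  { (inferInstance : AddCommGroup M.TensorRing) with
    mul := fun x y => mulHom x y
    one := unit
    mul_assoc := mulHom_assoc
    one_mul := mulHom_unit
    mul_one := mulHom_unit_right
    left_distrib := fun x y z => map_add (mulHom x) y z
    right_distrib := fun x y z => DFunLike.congr_fun (map_add mulHom x y) z
    zero_mul := fun x => DFunLike.congr_fun (map_zero mulHom) x
    mul_zero := fun x => map_zero (mulHom x) }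

theorem mul_def (x y : M.TensorRing) : x * y = mulHom x y := rfl

variable (M) in
/-- The inclusion of `R = M^{⊗ 0}` into `T_R(M)`. -/
def incl : R →+* M.TensorRing where
  toFun r := ofScalar r
  map_one' := rfl
  map_mul' r s := by rw [mul_def, mulHom_ofScalar, ← map_smul, smul_eq_mul]
  map_zero' := map_zero _
  map_add' r s := map_add _ r s

theorem incl_mul (r : R) (x : M.TensorRing) : incl M r * x = r • x :=
  mulHom_ofScalar r x

/-- The inclusion of `M` into `T_R(M)`, sending `m` to `m ⊗ 1 ∈ M^{⊗ 1} = M ⊗_R R`. -/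
def gen : M.carrier →+ M.TensorRing :=
  (of (M := M) 1).toAddMonoidHom.comp ((cons (M := M) 0).flip (1 : R))

theorem gen_apply (m : M.carrier) : gen m = shift m 1 :=
  (shift_of m 0 (1 : R)).symm

theorem gen_mul (m : M.carrier) (x : M.TensorRing) : gen m * x = shift m x := by
  rw [gen_apply, mul_def, mulHom_shift, ← mul_def, one_mul]

theorem incl_mul_gen (r : R) (m : M.carrier) : incl M r * gen m = gen (r • m) := by
  rw [incl_mul, gen_apply, gen_apply, shift_smul_left]

theorem gen_mul_incl (m : M.carrier) (r : R) : gen m * incl M r = gen (op r • m) := by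
  rw [gen_mul, gen_apply, shift_smul_right, ← incl_mul, mul_one]

end TensorRing

/-! ## Right modules over the tensor ring -/

/-- The right `R`-module `Hom_{Rᵒᵖ}(P, Y)` of right `R`-linear maps `P → Y`, with
`(f · r)(p) = f (r · p)`. -/
def homRight (P : RingBimodule R) (Y : ModuleCat.{u} Rᵐᵒᵖ) : ModuleCat.{u} Rᵐᵒᵖ :=
  letI : Module Rᵐᵒᵖ (P.carrier →ₗ[Rᵐᵒᵖ] Y) :=
    { smul := fun r f =>
        { toFun := fun p => f (r.unop • p)
          map_add' := fun p q => by rw [smul_add, map_add]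
          map_smul' := fun s p => by
            rw [smul_comm, map_smul, RingHom.id_apply] }
      one_smul := fun f => LinearMap.ext fun p => congrArg f (one_smul R p)
      mul_smul := fun r s f => LinearMap.ext fun p =>
        congrArg f (mul_smul s.unop r.unop p)
      smul_zero := fun r => rfl
      smul_add := fun r f g => rfl
      add_smul := fun r s f => LinearMap.ext fun p =>
        (congrArg f (add_smul r.unop s.unop p)).trans (map_add f _ _)
      zero_smul := fun f => LinearMap.ext fun p =>
        (congrArg f (zero_smul R p)).trans (map_zero f) }
  ModuleCat.of Rᵐᵒᵖ (P.carrier →ₗ[Rᵐᵒᵖ] Y)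

/-- The forgetful functor `U` from right `T_R(M)`-modules to right `R`-modules. -/
noncomputable abbrev forgetT (M : RingBimodule R) :
    ModuleCat.{u} M.TensorRingᵐᵒᵖ ⥤ ModuleCat.{u} Rᵐᵒᵖ :=
  ModuleCat.restrictScalars (TensorRing.incl M).op

/-- `Coind(Y) = Hom_{Rᵒᵖ}(T_R(M), Y)`, with `(f · t)(s) = f (t s)`; the right adjoint of `U`. -/
noncomputable abbrev coind (M : RingBimodule R) :
    ModuleCat.{u} Rᵐᵒᵖ ⥤ ModuleCat.{u} M.TensorRingᵐᵒᵖ :=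
  ModuleCat.coextendScalars (TensorRing.incl M).op

/-- Right multiplication `y ↦ y · t` by `t ∈ T_R(M)` on the underlying right `R`-module of the
right `T_R(M)`-module `A`. -/
def act (M : RingBimodule R) (A : ModuleCat.{u} M.TensorRingᵐᵒᵖ) (t : M.TensorRing) :
    M.forgetT.obj A →+ M.forgetT.obj A :=
  DistribSMul.toAddMonoidHom A (op t)

theorem act_incl (M : RingBimodule R) (A : ModuleCat.{u} M.TensorRingᵐᵒᵖ) (r : Rᵐᵒᵖ)
    (y : M.forgetT.obj A) : M.act A (TensorRing.incl M r.unop) y = r • y := rfl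

theorem act_add (M : RingBimodule R) (A : ModuleCat.{u} M.TensorRingᵐᵒᵖ) (s t : M.TensorRing)
    (y : M.forgetT.obj A) : M.act A (s + t) y = M.act A s y + M.act A t y :=
  add_smul (op s) (op t) (show A from y)

theorem act_mul (M : RingBimodule R) (A : ModuleCat.{u} M.TensorRingᵐᵒᵖ) (s t : M.TensorRing)
    (y : M.forgetT.obj A) : M.act A (s * t) y = M.act A t (M.act A s y) :=
  mul_smul (op t) (op s) (show A from y)

/-- The map `v : Y → Hom_{Rᵒᵖ}(M, Y)`, `v(y)(m) = y · m`, of the right `T_R(M)`-module `A` with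
underlying right `R`-module `Y = U(A)`. Thus `A` corresponds to the pair `[Y, v]`. -/
noncomputable def structureMap (M : RingBimodule R) (A : ModuleCat.{u} M.TensorRingᵐᵒᵖ) :
    M.forgetT.obj A ⟶ M.homRight (M.forgetT.obj A) :=
  ModuleCat.ofHom (X := M.forgetT.obj A) (Y := M.homRight (M.forgetT.obj A))
    { toFun := fun y =>
        ({ toFun := fun m => M.act A (TensorRing.gen m) y
           map_add' := fun m n => by rw [map_add, act_add]
           map_smul' := fun r m => by
            rw [RingHom.id_apply, ← act_incl, ← act_mul, TensorRing.gen_mul_incl, op_unop] } :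
          M.carrier →ₗ[Rᵐᵒᵖ] M.forgetT.obj A)
      map_add' := fun y z => LinearMap.ext fun m => map_add (M.act A (TensorRing.gen m)) y z
      map_smul' := fun r y => LinearMap.ext fun m => by
        change M.act A (TensorRing.gen m) (r • y) = M.act A (TensorRing.gen (r.unop • m)) y
        rw [← act_incl, ← act_mul, TensorRing.incl_mul_gen] }

/-- `Ψ(𝒵)`: the right `T_R(M)`-modules `[Y, v]` with `v` an epimorphism and `ker v ∈ 𝒵`. -/
noncomputable def psi (M : RingBimodule R) (Z : ObjectProperty (ModuleCat.{u} Rᵐᵒᵖ)) :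
    ObjectProperty (ModuleCat.{u} M.TensorRingᵐᵒᵖ) :=
  fun A => Epi (M.structureMap A) ∧ Z (kernel (M.structureMap A))

end

end RingBimodule

/-! ## Relative Gorenstein injective objects -/

section

variable {C : Type*} [Category C] [Abelian C]

/-- The complex `Hom(Y, I)` of abelian groups. -/
noncomputable abbrev homFrom (Y : C) (I : CochainComplex C ℤ) : CochainComplex AddCommGrpCat ℤ :=
  ((preadditiveCoyoneda.obj (Opposite.op Y)).mapHomologicalComplex (ComplexShape.up ℤ)).obj I

/-- A `𝒴`-complete injective resolution: an exact complex of injective objects that remains exact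
under `Hom(Y, -)` for all `Y ∈ 𝒴`. -/
structure IsCompleteInjectiveResolution (Y : ObjectProperty C) (I : CochainComplex C ℤ) :
    Prop where
  injective : ∀ n, Injective (I.X n)
  exact : I.Acyclic
  hom_exact : ∀ B, Y B → (homFrom B I).Acyclic

/-- The `𝒴`-Gorenstein injective objects: those isomorphic to `ker (I⁰ → I¹)` for some
`𝒴`-complete injective resolution `I`. -/
def gorensteinInjective (Y : ObjectProperty C) : ObjectProperty C :=
  fun H => ∃ I : CochainComplex C ℤ, IsCompleteInjectiveResolution Y I ∧
    Nonempty (H ≅ kernel (I.d 0 1))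

end

namespace RingBimodule

section

variable {R : Type u} [Ring R]

/-- `M` is co-compatible with respect to `𝒴`. -/
structure IsCocompatible (M : RingBimodule R) (Y : ObjectProperty (ModuleCat.{u} Rᵐᵒᵖ)) :
    Prop where
  hom_exact : ∀ I : CochainComplex (ModuleCat.{u} M.TensorRingᵐᵒᵖ) ℤ,
    IsCompleteInjectiveResolution (Y.map M.coind) I →
      (homFrom M.toRight ((M.forgetT.mapHomologicalComplex (ComplexShape.up ℤ)).obj I)).Acyclic
  coind_hom_exact : ∀ I : CochainComplex (ModuleCat.{u} M.TensorRingᵐᵒᵖ) ℤ,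
    IsCompleteInjectiveResolution (Y.map M.coind) I →
      ∀ B, Y B → (homFrom (M.coind.obj (M.homRight B)) I).Acyclic

/-- `M` is co-admissible with respect to `𝒴`. -/
structure IsCoadmissible (M : RingBimodule R) (Y : ObjectProperty (ModuleCat.{u} Rᵐᵒᵖ)) :
    Prop where
  ext_hom_pow : ∀ H, gorensteinInjective Y H → ∀ B, Y B → ∀ i : ℕ,
    Subsingleton (Abelian.Ext ((M.pow i).homRight B) H 1)
  ext_pow_hom : ∀ H, gorensteinInjective Y H → ∀ i : ℕ,
    Subsingleton (Abelian.Ext M.toRight ((M.pow i).homRight H) 1)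

end

end RingBimodule

/-! Let K (`kerStructureMap`) send [Y, v] to ker v. It is right adjoint to `triv`, which lets M act
by zero, and K(Coind X) ≅ X. Two facts carry the proof. By the snake lemma, K keeps 0 → A → E → C →
0 exact as soon as the structure map of A is surjective (`shortExact_kerStructureMap`). And T = R ⊕
(T ⊗ M) gives the exact sequence 0 → triv X → Coind X → Coind Hom(M, X) → 0 (`shortExact_coind`).

Let I be a Coind(𝒴)-complete injective resolution with cycles Zⁿ. Co-compatibility makes v
surjective on every Zⁿ, so K(I) is an exact complex of injectives with cycles K(Zⁿ). Moreover Hom(B,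
K(I)) ≅ Hom(triv B, I) is exact for B in 𝒴, because Hom(-, I) is exact on the other two terms of the
sequence for X = B. Hence each K(Zⁿ) is 𝒴-Gorenstein injective.

For the converse, a class consists of Gorenstein injectives once each member starts and ends a
suitable short exact sequence inside the class (`gorensteinInjective_of_step`). Let v be surjective
on A with K(A) Gorenstein injective. Nilpotency filters Coind B finitely, with factors triv Hom(M^{⊗
i}, B). As Ext¹(triv X, A) vanishes with Ext¹(X, K(A)), co-admissibility yields Ext¹(Coind B, A) =
0, hence the required lifting of maps. An embedding K(A) → I extends to UA → I, whose adjoint A →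
Coind I is injective by nilpotency. A cover I → K(A) is a map triv I → A; it extends to Coind I → A,
which is surjective by nilpotency. The cokernel of the former and the kernel of the latter again lie
in the class. -/

section

/-! ### Relative Gorenstein injectives built step by step. -/

variable {C : Type*} [Category C] [Abelian C]

/-- There is a short exact sequence `0 → A → E → B → 0` with `E` injective such that all maps from
objects in `Y` to `B` lift to `E`. -/
def InjectiveStep (Y : ObjectProperty C) (A B : C) : Prop :=
  ∃ (E : C) (f : A ⟶ E) (g : E ⟶ B) (w : f ≫ g = 0), (ShortComplex.mk f g w).ShortExact ∧
    Injective E ∧ ∀ P, Y P → ∀ φ : P ⟶ B, ∃ ψ : P ⟶ E, ψ ≫ g = φ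

/-- Splicing: composing with an epimorphism on the left and a monomorphism on the right changes
neither the image nor the kernel at E'. -/
theorem exact_comp_of_shortExact {A E B E' B' : C} {f : A ⟶ E} {g : E ⟶ B} {w : f ≫ g = 0}
    {f' : B ⟶ E'} {g' : E' ⟶ B'} {w' : f' ≫ g' = 0} {E'' : C} {f'' : B' ⟶ E''} [Mono f'']
    (h : (ShortComplex.mk f g w).ShortExact) (h' : (ShortComplex.mk f' g' w').ShortExact)
    (w'' : (g ≫ f') ≫ (g' ≫ f'') = 0) :
    (ShortComplex.mk (g ≫ f') (g' ≫ f'') w'').Exact := by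
  have := h.epi_g
  dsimp at this
  let S : ShortComplex C := ShortComplex.mk (g ≫ f') g' (by rw [Category.assoc, w', comp_zero])
  let φ : S ⟶ ShortComplex.mk (g ≫ f') (g' ≫ f'') w'' :=
    { τ₁ := 𝟙 _, τ₂ := 𝟙 _, τ₃ := f'' }
  let ψ : S ⟶ ShortComplex.mk f' g' w' :=
    { τ₁ := g, τ₂ := 𝟙 _, τ₃ := 𝟙 _ }
  have : Epi φ.τ₁ := inferInstanceAs (Epi (𝟙 _))
  have : IsIso φ.τ₂ := inferInstanceAs (IsIso (𝟙 _))
  have : Mono φ.τ₃ := inferInstanceAs (Mono f'')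
  have : Epi ψ.τ₁ := inferInstanceAs (Epi g)
  have : IsIso ψ.τ₂ := inferInstanceAs (IsIso (𝟙 _))
  have : Mono ψ.τ₃ := inferInstanceAs (Mono (𝟙 _))
  rw [← ShortComplex.exact_iff_of_epi_of_isIso_of_mono φ,
    ShortComplex.exact_iff_of_epi_of_isIso_of_mono ψ]
  exact h'.exact

theorem CochainComplex.acyclic_iff_sc' (I : CochainComplex C ℤ) :
    I.Acyclic ↔ ∀ n : ℤ, (I.sc' n (n + 1) (n + 1 + 1)).Exact := by
  refine ⟨fun h n => (I.exactAt_iff' n (n + 1) (n + 1 + 1) (by simp) (by simp)).1 (h _),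
    fun h n => ?_⟩
  obtain ⟨m, rfl⟩ : ∃ m, n = m + 1 := ⟨n - 1, by simp⟩
  exact (I.exactAt_iff' m (m + 1) (m + 1 + 1) (by simp) (by simp)).2 (h m)

theorem homFrom_acyclic_iff (B : C) (I : CochainComplex C ℤ) :
    (homFrom B I).Acyclic ↔ ∀ (n : ℤ) (x : B ⟶ I.X (n + 1)), x ≫ I.d (n + 1) (n + 1 + 1) = 0 →
      ∃ y : B ⟶ I.X n, y ≫ I.d n (n + 1) = x := by
  rw [CochainComplex.acyclic_iff_sc']
  refine forall_congr' fun n => ?_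
  rw [ShortComplex.ab_exact_iff]
  rfl

theorem exists_int_chain {α : Type*} {r : α → α → Prop}
    (hr : ∀ a, ∃ b, r a b) (hl : ∀ a, ∃ b, r b a) (a : α) :
    ∃ s : ℤ → α, s 0 = a ∧ ∀ n, r (s n) (s (n + 1)) := by
  choose f hf using hr
  choose g hg using hl
  -- `Int.negSucc k` is -(k + 1), hence the exponent k + 1; the passage from -1 to 0 is a separate
  -- case below.
  refine ⟨fun n => Int.casesOn n (fun k => f^[k] a) (fun k => g^[k + 1] a), rfl, fun n => ?_⟩
  match n with
  | Int.ofNat k =>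
    change r (f^[k] a) (f^[k + 1] a)
    rw [Function.iterate_succ_apply']
    exact hf _
  | Int.negSucc 0 => exact hg a
  | Int.negSucc (k + 1) =>
    change r (g^[k + 1 + 1] a) (g^[k + 1] a)
    rw [Function.iterate_succ_apply' g (k + 1)]
    exact hg _

/-- Coinduction principle for relative Gorenstein injective objects. -/
theorem gorensteinInjective_of_step {Y X : ObjectProperty C}
    (hr : ∀ A, X A → ∃ B, X B ∧ InjectiveStep Y A B)
    (hl : ∀ A, X A → ∃ B, X B ∧ InjectiveStep Y B A) : X ≤ gorensteinInjective Y := by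
  intro A hA
  obtain ⟨s, hs0, hs⟩ := exists_int_chain (α := {A : C // X A})
    (r := fun A B => InjectiveStep Y A.1 B.1)
    (fun A => let ⟨B, hB, h⟩ := hr A.1 A.2; ⟨⟨B, hB⟩, h⟩)
    (fun A => let ⟨B, hB, h⟩ := hl A.1 A.2; ⟨⟨B, hB⟩, h⟩) ⟨A, hA⟩
  choose E f g w hS hE hY using hs
  have hf (n : ℤ) : Mono (f n) := (hS n).mono_f
  have hd (n : ℤ) : (g n ≫ f (n + 1)) ≫ g (n + 1) ≫ f (n + 1 + 1) = 0 := by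
    simp [reassoc_of% (w (n + 1))]
  let I : CochainComplex C ℤ := CochainComplex.of E (fun n => g n ≫ f (n + 1)) hd
  have hI (n : ℤ) : I.d n (n + 1) = g n ≫ f (n + 1) :=
    CochainComplex.of_d E (fun n => g n ≫ f (n + 1)) n
  refine ⟨I, ⟨hE, ?_, fun B hB => ?_⟩, ?_⟩
  · rw [CochainComplex.acyclic_iff_sc']
    intro n
    have h := exact_comp_of_shortExact (f'' := f (n + 1 + 1)) (hS n) (hS (n + 1)) (hd n)
    convert h using 1
    unfold HomologicalComplex.sc' HomologicalComplex.shortComplexFunctor'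
    dsimp
    congr 1 <;> exact hI _
  · rw [homFrom_acyclic_iff]
    intro n x hx
    -- Cancelling the last monomorphism leaves x ≫ g (n + 1) = 0. So x factors through f (n + 1),
    -- and the factor lifts along g n.
    rw [hI, ← Category.assoc, ← zero_comp (f := f (n + 1 + 1)), cancel_mono] at hx
    have := (hS (n + 1)).mono_f
    obtain ⟨ψ, hψ⟩ := hY n B hB ((hS (n + 1)).exact.lift x hx)
    refine ⟨ψ, ?_⟩
    rw [hI, reassoc_of% hψ]
    exact (hS (n + 1)).exact.lift_f x hx
  · have h0 : I.d 0 1 = g 0 ≫ f 1 := hI 0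
    have : Mono (f 1) := hf 1
    have := (hS 0).mono_f
    -- Since f 1 is mono, ker (g 0 ≫ f 1) = ker (g 0), and this is the left end of the 0-th
    -- sequence.
    rw [show A = (s 0).1 by rw [hs0]]
    exact ⟨((hS 0).fIsKernel).conePointUniqueUpToIso (limit.isLimit _) ≪≫
      (kernelCompMono (g 0) (f 1)).symm ≪≫ (kernelIsoOfEq h0).symm⟩

/-- The cycles of a cochain complex. -/
noncomputable abbrev cyclesAt (I : CochainComplex C ℤ) (n : ℤ) : C := kernel (I.d n (n + 1))

/-- The map `I n → Z (n + 1)`. -/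
noncomputable def toCyclesAt (I : CochainComplex C ℤ) (n : ℤ) : I.X n ⟶ cyclesAt I (n + 1) :=
  kernel.lift _ (I.d n (n + 1)) (I.d_comp_d _ _ _)

@[simp]
theorem toCyclesAt_ι (I : CochainComplex C ℤ) (n : ℤ) :
    toCyclesAt I n ≫ kernel.ι _ = I.d n (n + 1) := kernel.lift_ι _ _ _

theorem ι_toCyclesAt (I : CochainComplex C ℤ) (n : ℤ) :
    kernel.ι (I.d n (n + 1)) ≫ toCyclesAt I n = 0 := by
  rw [← cancel_mono (kernel.ι _), Category.assoc, toCyclesAt_ι, kernel.condition, zero_comp]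

theorem shortExact_cyclesAt {I : CochainComplex C ℤ} (hI : I.Acyclic) (n : ℤ) :
    (ShortComplex.mk _ _ (ι_toCyclesAt I n)).ShortExact := by
  have hepi : Epi (toCyclesAt I n) := by
    have h := (CochainComplex.acyclic_iff_sc' I).1 hI n
    exact (ShortComplex.exact_iff_epi_kernel_lift _).1 h
  refine { exact := ?_, mono_f := inferInstanceAs (Mono (kernel.ι _)), epi_g := hepi }
  let S : ShortComplex C := ShortComplex.mk (kernel.ι (I.d n (n + 1))) _ (kernel.condition _)
  let φ : ShortComplex.mk _ _ (ι_toCyclesAt I n) ⟶ S :=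
    { τ₁ := 𝟙 _, τ₂ := 𝟙 _, τ₃ := kernel.ι _ }
  have : Epi φ.τ₁ := inferInstanceAs (Epi (𝟙 _))
  have : IsIso φ.τ₂ := inferInstanceAs (IsIso (𝟙 _))
  have : Mono φ.τ₃ := inferInstanceAs (Mono (kernel.ι _))
  rw [ShortComplex.exact_iff_of_epi_of_isIso_of_mono φ]
  exact ShortComplex.exact_kernel _

theorem lift_toCyclesAt {I : CochainComplex C ℤ} {B : C} (h : (homFrom B I).Acyclic) {n : ℤ}
    (φ : B ⟶ cyclesAt I (n + 1)) : ∃ ψ : B ⟶ I.X n, ψ ≫ toCyclesAt I n = φ := by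
  obtain ⟨y, hy⟩ := (homFrom_acyclic_iff B I).1 h n (φ ≫ kernel.ι _)
    (by rw [Category.assoc, kernel.condition, comp_zero])
  exact ⟨y, by rw [← cancel_mono (kernel.ι _), Category.assoc, toCyclesAt_ι, hy]⟩

theorem InjectiveStep.congr {Y : ObjectProperty C} {A B A' B' : C} (h : InjectiveStep Y A B)
    (a : A ≅ A') (b : B ≅ B') : InjectiveStep Y A' B' := by
  obtain ⟨E, f, g, w, hS, hE, hY⟩ := h
  refine ⟨E, a.inv ≫ f, g ≫ b.hom, by simp [reassoc_of% w], ?_, hE, fun P hP φ => ?_⟩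
  · exact ShortComplex.shortExact_of_iso
      (ShortComplex.isoMk a (Iso.refl E) b (by simp) (by simp)) hS
  · obtain ⟨ψ, hψ⟩ := hY P hP (φ ≫ b.inv)
    exact ⟨ψ, by rw [reassoc_of% hψ, b.inv_hom_id, Category.comp_id]⟩

theorem injectiveStep_cyclesAt {Y : ObjectProperty C} {I : CochainComplex C ℤ}
    (hI : IsCompleteInjectiveResolution Y I) (n : ℤ) :
    InjectiveStep Y (cyclesAt I n) (cyclesAt I (n + 1)) :=
  ⟨_, _, _, _, shortExact_cyclesAt hI.exact n, hI.injective n,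
    fun B hB φ => lift_toCyclesAt (hI.hom_exact B hB) φ⟩

/-- A ℤ-indexed family supplies both neighbours of each member. This serves the cycles of a
resolution and also their images under K, without shifting or rebuilding a complex. -/
theorem gorensteinInjective_of_step_of_cycles {Y X : ObjectProperty C}
    (h : ∀ A, X A → ∃ (Z : ℤ → C) (n : ℤ), Nonempty (A ≅ Z n) ∧
      ∀ m, X (Z m) ∧ InjectiveStep Y (Z m) (Z (m + 1))) : X ≤ gorensteinInjective Y := by
  refine gorensteinInjective_of_step (fun A hA => ?_) (fun A hA => ?_)
  · obtain ⟨Z, n, ⟨e⟩, hZ⟩ := h A hA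
    exact ⟨_, (hZ (n + 1)).1, (hZ n).2.congr e.symm (Iso.refl _)⟩
  · obtain ⟨Z, n, ⟨e⟩, hZ⟩ := h A hA
    obtain ⟨m, rfl⟩ : ∃ m, n = m + 1 := ⟨n - 1, by simp⟩
    exact ⟨_, (hZ m).1, (hZ m).2.congr (Iso.refl _) e.symm⟩

theorem IsCompleteInjectiveResolution.cyclesAt {Y : ObjectProperty C} {I : CochainComplex C ℤ}
    (hI : IsCompleteInjectiveResolution Y I) (n : ℤ) :
    gorensteinInjective Y (cyclesAt I n) := by
  refine gorensteinInjective_of_step_of_cycles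
    (X := fun A => ∃ n, Nonempty (A ≅ _root_.cyclesAt I n)) ?_ _ ⟨n, ⟨Iso.refl _⟩⟩
  rintro A ⟨n, ⟨e⟩⟩
  exact ⟨_root_.cyclesAt I, n, ⟨e⟩, fun m => ⟨⟨m, ⟨Iso.refl _⟩⟩, injectiveStep_cyclesAt hI m⟩⟩

theorem gorensteinInjective.congr {Y : ObjectProperty C} {A B : C}
    (h : gorensteinInjective Y A) (e : A ≅ B) : gorensteinInjective Y B := by
  obtain ⟨I, hI, ⟨e'⟩⟩ := h
  exact ⟨I, hI, ⟨e.symm ≪≫ e'⟩⟩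

theorem gorensteinInjective.exists_step_right {Y : ObjectProperty C} {A : C}
    (h : gorensteinInjective Y A) : ∃ B, gorensteinInjective Y B ∧ InjectiveStep Y A B := by
  obtain ⟨I, hI, ⟨e⟩⟩ := h
  exact ⟨_, hI.cyclesAt (0 + 1), (injectiveStep_cyclesAt hI 0).congr e.symm (Iso.refl _)⟩

theorem gorensteinInjective.exists_step_left {Y : ObjectProperty C} {A : C}
    (h : gorensteinInjective Y A) : ∃ B, gorensteinInjective Y B ∧ InjectiveStep Y B A := by
  obtain ⟨I, hI, ⟨e⟩⟩ := h
  exact ⟨_, hI.cyclesAt (-1), (injectiveStep_cyclesAt hI (-1)).congr (Iso.refl _) e.symm⟩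

open ZeroObject in
-- Both steps have A itself in the middle and 0 at the other end, and maps lift trivially. The case
-- needed later is K(Coind I) ≅ I.
theorem gorensteinInjective_of_injective (Y : ObjectProperty C) (A : C) [hA : Injective A] :
    gorensteinInjective Y A := by
  have h0 : Injective (0 : C) := Injective.zero_injective
  have hid {A : C} : (ShortComplex.mk (𝟙 A) (0 : A ⟶ 0) comp_zero).ShortExact :=
    { exact := (ShortComplex.exact_iff_epi _ rfl).2 (inferInstanceAs (Epi (𝟙 A)))
      mono_f := inferInstanceAs (Mono (𝟙 A))
      epi_g := ⟨fun _ _ _ => (isZero_zero C).eq_of_src _ _⟩ }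
  have hid' {A : C} : (ShortComplex.mk (0 : 0 ⟶ A) (𝟙 A) zero_comp).ShortExact :=
    { exact := (ShortComplex.exact_iff_mono _ rfl).2 (inferInstanceAs (Mono (𝟙 A)))
      mono_f := ⟨fun _ _ _ => (isZero_zero C).eq_of_tgt _ _⟩
      epi_g := inferInstanceAs (Epi (𝟙 A)) }
  refine gorensteinInjective_of_step (X := fun A => Injective A) (fun A hA => ⟨0, h0, ?_⟩)
    (fun A hA => ⟨0, h0, ?_⟩) A hA
  · exact ⟨A, _, _, _, hid, hA, fun P _ φ => ⟨0, (isZero_zero C).eq_of_tgt _ _⟩⟩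
  · exact ⟨A, _, _, _, hid', hA, fun P _ φ => ⟨φ, Category.comp_id φ⟩⟩

end

/-! ### Vanishing of Ext¹ as lifting and extension. -/

section

variable {C : Type*} [Category C] [Abelian C] [HasExt C]

open Abelian

theorem CategoryTheory.Abelian.Ext.subsingleton_of_forall_eq_zero {X A : C} {n : ℕ}
    (h : ∀ x : Ext X A n, x = 0) :
    Subsingleton (Ext X A n) := ⟨fun x y => (h x).trans (h y).symm⟩

/-- The obstruction to lifting φ is its product with the extension class, an element of Ext¹(X, X₁).
-/
theorem CategoryTheory.ShortComplex.ShortExact.exists_lift_of_ext {S : ShortComplex C}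
    (hS : S.ShortExact) {X : C} (h : Subsingleton (Ext X S.X₁ 1)) (φ : X ⟶ S.X₃) :
    ∃ ψ : X ⟶ S.X₂, ψ ≫ S.g = φ := by
  obtain ⟨x, hx⟩ := Ext.covariant_sequence_exact₃ X hS (Ext.mk₀ φ) (zero_add 1)
    (Subsingleton.elim _ _)
  obtain ⟨ψ, rfl⟩ := (Ext.mk₀_bijective X S.X₂).2 x
  rw [Ext.mk₀_comp_mk₀] at hx
  exact ⟨ψ, (Ext.mk₀_bijective X S.X₃).1 hx⟩

theorem CategoryTheory.ShortComplex.ShortExact.exists_extend_of_ext {S : ShortComplex C}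
    (hS : S.ShortExact) {A : C} (h : Subsingleton (Ext S.X₃ A 1)) (φ : S.X₁ ⟶ A) :
    ∃ ψ : S.X₂ ⟶ A, S.f ≫ ψ = φ := by
  obtain ⟨x, hx⟩ := Ext.contravariant_sequence_exact₁ hS A (Ext.mk₀ φ) (add_zero 1)
    (Subsingleton.elim _ _)
  obtain ⟨ψ, rfl⟩ := (Ext.mk₀_bijective S.X₂ A).2 x
  rw [Ext.mk₀_comp_mk₀] at hx
  exact ⟨ψ, (Ext.mk₀_bijective S.X₁ A).1 hx⟩

/-- Injectivity of X₂ makes the connecting map Hom(X, X₃) → Ext¹(X, X₁) surjective, and it kills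
every map that lifts. -/
theorem CategoryTheory.ShortComplex.ShortExact.subsingleton_ext_of_lift {S : ShortComplex C}
    (hS : S.ShortExact) [Injective S.X₂] {X : C} (h : ∀ φ : X ⟶ S.X₃, ∃ ψ : X ⟶ S.X₂, ψ ≫ S.g = φ) :
    Subsingleton (Ext X S.X₁ 1) := by
  refine Ext.subsingleton_of_forall_eq_zero fun x => ?_
  obtain ⟨y, rfl⟩ := Ext.covariant_sequence_exact₁ X hS x (Ext.eq_zero_of_injective _) (zero_add 1)
  obtain ⟨φ, rfl⟩ := (Ext.mk₀_bijective X S.X₃).2 y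
  obtain ⟨ψ, rfl⟩ := h φ
  rw [← Ext.mk₀_comp_mk₀, Ext.comp_assoc_of_second_deg_zero, hS.comp_extClass, Ext.comp_zero]

theorem CategoryTheory.ShortComplex.ShortExact.subsingleton_ext_middle {S : ShortComplex C}
    (hS : S.ShortExact) {X : C} {n : ℕ} (h₁ : Subsingleton (Ext X S.X₁ n))
    (h₃ : Subsingleton (Ext X S.X₃ n)) : Subsingleton (Ext X S.X₂ n) := by
  refine Ext.subsingleton_of_forall_eq_zero fun x => ?_
  obtain ⟨y, rfl⟩ := Ext.covariant_sequence_exact₂ X hS x (Subsingleton.elim _ _)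
  rw [Subsingleton.elim y 0, Ext.zero_comp]

theorem CategoryTheory.ShortComplex.ShortExact.subsingleton_ext_middle' {S : ShortComplex C}
    (hS : S.ShortExact) {A : C} {n : ℕ} (h₁ : Subsingleton (Ext S.X₁ A n))
    (h₃ : Subsingleton (Ext S.X₃ A n)) : Subsingleton (Ext S.X₂ A n) := by
  refine Ext.subsingleton_of_forall_eq_zero fun x => ?_
  obtain ⟨y, rfl⟩ := Ext.contravariant_sequence_exact₂ hS A x (Subsingleton.elim _ _)
  rw [Subsingleton.elim y 0, Ext.comp_zero]

theorem CategoryTheory.Abelian.Ext.subsingleton_congr {X X' A A' : C} {n : ℕ}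
    (e : X ≅ X') (e' : A ≅ A')
    (h : Subsingleton (Ext X A n)) : Subsingleton (Ext X' A' n) := by
  refine Ext.subsingleton_of_forall_eq_zero fun x => ?_
  have hx : (Ext.mk₀ e.inv).comp ((Ext.mk₀ e.hom).comp x (zero_add n)) (zero_add n) = x := by
    rw [Ext.mk₀_comp_mk₀_assoc, e.inv_hom_id, Ext.mk₀_id_comp]
  have hy : (((Ext.mk₀ e.hom).comp x (zero_add n)).comp (Ext.mk₀ e'.inv) (add_zero n)).comp
      (Ext.mk₀ e'.hom) (add_zero n) = (Ext.mk₀ e.hom).comp x (zero_add n) := by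
    rw [Ext.comp_assoc_of_third_deg_zero, Ext.mk₀_comp_mk₀, e'.inv_hom_id, Ext.comp_mk₀_id]
  rw [← hx, ← hy, Subsingleton.elim (Ext.comp _ (Ext.mk₀ e'.inv) _) 0, Ext.zero_comp, Ext.comp_zero]

theorem CategoryTheory.Abelian.Ext.subsingleton_of_isZero {X A : C} {n : ℕ} (h : IsZero A) :
    Subsingleton (Ext X A n) := by
  refine Ext.subsingleton_of_forall_eq_zero fun x => ?_
  rw [← Ext.comp_mk₀_id x, h.eq_of_src (𝟙 A) 0, Ext.mk₀_zero, Ext.comp_zero]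

theorem CategoryTheory.Abelian.Ext.subsingleton_of_isZero' {X A : C} {n : ℕ} (h : IsZero X) :
    Subsingleton (Ext X A n) := by
  refine Ext.subsingleton_of_forall_eq_zero fun x => ?_
  rw [← Ext.mk₀_id_comp x, h.eq_of_src (𝟙 X) 0, Ext.mk₀_zero, Ext.zero_comp]

end

/-! ### The augmentation T → R, trivial modules and the functor ker v. -/

namespace RingBimodule

section

variable {R : Type u} [Ring R]

namespace TensorRing

variable {M : RingBimodule R}

theorem of_succ_cons (i : ℕ) (a : M.carrier) (x : (M.pow i).carrier) :
    of (i + 1) (cons i a x) = gen a * of i x := by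
  rw [gen_mul, shift_of]

variable (M) in
/-- The projection onto the summand `R = M^{⊗ 0}` of the tensor ring. -/
def augHom : M.TensorRing →+ R :=
  DirectSum.toAddMonoid (β := fun i => (M.pow i).carrier) fun i => match i with
    | 0 => AddMonoidHom.id R
    | _ + 1 => 0

theorem augHom_incl (r : R) : augHom M (incl M r) = r :=
  DirectSum.toAddMonoid_of (β := fun i => (M.pow i).carrier) _ 0 r

theorem augHom_of_succ (i : ℕ) (x : (M.pow (i + 1)).carrier) : augHom M (of (i + 1) x) = 0 :=
  DirectSum.toAddMonoid_of (β := fun i => (M.pow i).carrier) _ (i + 1) x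

theorem augHom_gen_mul (a : M.carrier) (t : M.TensorRing) : augHom M (gen a * t) = 0 :=
  DFunLike.congr_fun (hom_ext (f := (augHom M).comp (AddMonoidHom.mulLeft (gen a)))
    (g := 0) fun i x => by
      change augHom M (gen a * of i x) = 0
      rw [← of_succ_cons, augHom_of_succ]) t

/-- Additively, T is generated by R and M · T, because each tensor of positive degree splits off its
leftmost factor. -/
theorem hom_ext_mul {C : Type*} [AddCommGroup C] {f g : M.TensorRing →+ C}
    (h0 : ∀ r, f (incl M r) = g (incl M r))
    (h : ∀ a t, f (gen a * t) = g (gen a * t)) : f = g :=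
  hom_ext fun i => match i with
    | 0 => h0
    | i + 1 => fun x => DFunLike.congr_fun (pow_succ_hom_ext
        (f := f.comp (of (i + 1)).toAddMonoidHom) (g := g.comp (of (i + 1)).toAddMonoidHom)
        fun a x => by
          change f (of (i + 1) _) = g (of (i + 1) _)
          rw [of_succ_cons]
          exact h _ _) x

theorem augHom_incl_mul (r : R) (t : M.TensorRing) : augHom M (incl M r * t) = r * augHom M t :=
  DFunLike.congr_fun (hom_ext_mul (f := (augHom M).comp (AddMonoidHom.mulLeft (incl M r)))
    (g := (AddMonoidHom.mulLeft r).comp (augHom M))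
    (fun s => by
      change augHom M (incl M r * incl M s) = r * augHom M (incl M s)
      rw [← map_mul, augHom_incl, augHom_incl])
    (fun a t => by
      change augHom M (incl M r * (gen a * t)) = r * augHom M (gen a * t)
      rw [← mul_assoc, incl_mul_gen, augHom_gen_mul, augHom_gen_mul, mul_zero])) t

variable (M) in
/-- The augmentation of the tensor ring. -/
def aug : M.TensorRing →+* R :=
  { augHom M with
    map_one' := augHom_incl 1
    map_mul' := fun s t => DFunLike.congr_fun (hom_ext_mul
      (f := (augHom M).comp (AddMonoidHom.mulRight t))
      (g := (AddMonoidHom.mulRight (augHom M t)).comp (augHom M))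
      (fun r => by
        change augHom M (incl M r * t) = augHom M (incl M r) * augHom M t
        rw [augHom_incl_mul, augHom_incl])
      (fun a s => by
        change augHom M (gen a * s * t) = augHom M (gen a * s) * augHom M t
        rw [mul_assoc, augHom_gen_mul, augHom_gen_mul, zero_mul])) s }

theorem aug_incl (r : R) : aug M (incl M r) = r := augHom_incl r

theorem aug_gen_mul (a : M.carrier) (t : M.TensorRing) : aug M (gen a * t) = 0 :=
  augHom_gen_mul a t

theorem aug_gen (a : M.carrier) : aug M (gen a) = 0 := by
  rw [← mul_one (gen a), aug_gen_mul]

end TensorRing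

open TensorRing

variable (M : RingBimodule R)

section homRight

variable {M} {X : ModuleCat.{u} Rᵐᵒᵖ}

/-- An element of `Hom(P, X)` as a linear map. -/
def toLin (f : M.homRight X) : M.carrier →ₗ[Rᵐᵒᵖ] X := f

/-- A linear map as an element of `Hom(P, X)`. -/
def ofLin (f : M.carrier →ₗ[Rᵐᵒᵖ] X) : M.homRight X := f

theorem toLin_ext {f g : M.homRight X} (h : ∀ m, toLin f m = toLin g m) : f = g :=
  LinearMap.ext h

theorem toLin_add (f g : M.homRight X) (m : M.carrier) :
    toLin (f + g) m = toLin f m + toLin g m := rfl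

theorem toLin_zero (m : M.carrier) : toLin (0 : M.homRight X) m = 0 := rfl

theorem toLin_smul (r : Rᵐᵒᵖ) (f : M.homRight X) (m : M.carrier) :
    toLin (r • f) m = toLin f (r.unop • m) := rfl

end homRight

section act

variable {M} {A B : ModuleCat.{u} M.TensorRingᵐᵒᵖ}

theorem act_one (y : M.forgetT.obj A) : M.act A 1 y = y := one_smul _ (show A from y)

theorem act_map (g : A ⟶ B) (t : M.TensorRing) (y : M.forgetT.obj A) :
    M.forgetT.map g (M.act A t y) = M.act B t (M.forgetT.map g y) :=
  g.hom.map_smul (op t) y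

theorem structureMap_apply (y : M.forgetT.obj A) (m : M.carrier) :
    toLin (M.structureMap A y) m = M.act A (gen m) y := rfl

theorem structureMap_eq_zero_iff {y : M.forgetT.obj A} :
    M.structureMap A y = 0 ↔ ∀ m, M.act A (gen m) y = 0 :=
  ⟨fun h m => by rw [← structureMap_apply, h, toLin_zero], fun h => toLin_ext h⟩

/-- An additive map commuting with the actions of `R` and `M` commutes with that of `T_R(M)`. -/
theorem map_act_of_gen (φ : M.forgetT.obj A →+ M.forgetT.obj B)
    (hR : ∀ (r : Rᵐᵒᵖ) y, φ (r • y) = r • φ y)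
    (h : ∀ m y, φ (M.act A (gen m) y) = M.act B (gen m) (φ y)) (t : M.TensorRing)
    (y : M.forgetT.obj A) : φ (M.act A t y) = M.act B t (φ y) := by
  let ev (D : ModuleCat.{u} M.TensorRingᵐᵒᵖ) (z : M.forgetT.obj D) :
      M.TensorRing →+ M.forgetT.obj D :=
    AddMonoidHom.mk' (fun t => M.act D t z) fun s t => act_add M D s t z
  suffices key : ∀ i (x : (M.pow i).carrier) y, φ (M.act A (of i x) y) = M.act B (of i x) (φ y) from
    DFunLike.congr_fun (hom_ext (f := φ.comp (ev A y)) (g := ev B (φ y)) fun i x => key i x y) t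
  intro i
  induction i with
  | zero => exact fun x y => hR (op x) y
  | succ i ih =>
    intro x y
    exact DFunLike.congr_fun (pow_succ_hom_ext
      (f := (φ.comp (ev A y)).comp (of (i + 1)).toAddMonoidHom)
      (g := (ev B (φ y)).comp (of (i + 1)).toAddMonoidHom)
      fun a x => by
        change φ (M.act A (of (i + 1) (cons i a x)) y) = M.act B (of (i + 1) (cons i a x)) (φ y)
        rw [of_succ_cons, act_mul, act_mul, ih, h]) x

/-- A right `R`-linear map commuting with the action of `M`, as a `T_R(M)`-linear map. -/
noncomputable def homMk (φ : M.forgetT.obj A ⟶ M.forgetT.obj B)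
    (h : ∀ m y, φ (M.act A (gen m) y) = M.act B (gen m) (φ y)) : A ⟶ B :=
  ModuleCat.ofHom
    { toFun := φ
      map_add' := φ.hom.map_add
      map_smul' := fun t y => map_act_of_gen φ.hom.toAddMonoidHom (fun r y => φ.hom.map_smul r y)
        h t.unop y }

end act

/-- A right `R`-module with the trivial action of `M`, as a right `T_R(M)`-module. -/
noncomputable def triv : ModuleCat.{u} Rᵐᵒᵖ ⥤ ModuleCat.{u} M.TensorRingᵐᵒᵖ :=
  ModuleCat.restrictScalars (aug M).op

/-- The kernel of the structure map `v` of `[Y, v]`, as a functor. -/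
noncomputable def kerStructureMap : ModuleCat.{u} M.TensorRingᵐᵒᵖ ⥤ ModuleCat.{u} Rᵐᵒᵖ where
  obj A := ModuleCat.of Rᵐᵒᵖ (LinearMap.ker (M.structureMap A).hom)
  map {A B} g := ModuleCat.ofHom
    ((M.forgetT.map g).hom.restrict (p := LinearMap.ker (M.structureMap A).hom)
      (q := LinearMap.ker (M.structureMap B).hom) fun y hy =>
        structureMap_eq_zero_iff.2 fun m => by
          rw [← act_map, structureMap_eq_zero_iff.1 hy, map_zero])
  map_id _ := rfl
  map_comp _ _ := rfl

section ker

variable {M} {A B : ModuleCat.{u} M.TensorRingᵐᵒᵖ} {X : ModuleCat.{u} Rᵐᵒᵖ}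

theorem mem_ker_structureMap {y : M.forgetT.obj A} :
    y ∈ LinearMap.ker (M.structureMap A).hom ↔ ∀ m, M.act A (gen m) y = 0 :=
  structureMap_eq_zero_iff

/-- The inclusion of `ker v` in `Y`. -/
noncomputable def kerι (A : ModuleCat.{u} M.TensorRingᵐᵒᵖ) :
    M.kerStructureMap.obj A ⟶ M.forgetT.obj A :=
  ModuleCat.ofHom (X := LinearMap.ker (M.structureMap A).hom) (Y := M.forgetT.obj A)
    (LinearMap.ker (M.structureMap A).hom).subtype

theorem kerι_injective : Function.Injective (kerι A) := Subtype.val_injective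

theorem act_gen_kerι (m : M.carrier) (y : M.kerStructureMap.obj A) :
    M.act A (gen m) (kerι A y) = 0 :=
  mem_ker_structureMap.1 y.2 m

theorem exists_kerι_eq {y : M.forgetT.obj A} (h : ∀ m, M.act A (gen m) y = 0) :
    ∃ z, kerι A z = y := ⟨⟨y, mem_ker_structureMap.2 h⟩, rfl⟩

theorem kerι_map_apply (g : A ⟶ B) (y : M.kerStructureMap.obj A) :
    kerι B (M.kerStructureMap.map g y) = M.forgetT.map g (kerι A y) := rfl

/-- A right `R`-linear map whose image is annihilated by `M` factors through `ker v`. -/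
noncomputable def kerLift (φ : X ⟶ M.forgetT.obj A) (h : ∀ m x, M.act A (gen m) (φ x) = 0) :
    X ⟶ M.kerStructureMap.obj A :=
  ModuleCat.ofHom (φ.hom.codRestrict (LinearMap.ker (M.structureMap A).hom)
    fun x => mem_ker_structureMap.2 fun m => h m x)

/-- `ker v` is the categorical kernel of `v`. -/
noncomputable def kernelStructureMapIso (A : ModuleCat.{u} M.TensorRingᵐᵒᵖ) :
    kernel (M.structureMap A) ≅ M.kerStructureMap.obj A :=
  ModuleCat.kernelIsoKer (M.structureMap A)

variable (M X) in
/-- The underlying right `R`-module of a trivial module. -/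
noncomputable def trivIso : X ≅ M.forgetT.obj (M.triv.obj X) where
  hom := ModuleCat.ofHom (X := X) (Y := M.forgetT.obj (M.triv.obj X))
    { toFun := fun x => x
      map_add' := fun _ _ => rfl
      map_smul' := fun r x => by
        change r • x = op (aug M (incl M r.unop)) • x
        rw [aug_incl, op_unop] }
  inv := ModuleCat.ofHom (X := M.forgetT.obj (M.triv.obj X)) (Y := X)
    { toFun := fun x => x
      map_add' := fun _ _ => rfl
      map_smul' := fun r (x : X) => by
        change op (aug M (incl M r.unop)) • x = r • x
        rw [aug_incl, op_unop] }
  hom_inv_id := rfl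
  inv_hom_id := rfl

theorem act_trivIso (t : M.TensorRing) (x : X) :
    M.act (M.triv.obj X) t ((trivIso M X).hom x) = (trivIso M X).hom (op (aug M t) • x) := rfl

variable (M) in
/-- Maps from a trivial module are maps to `ker v`. -/
noncomputable def trivHomEquiv (X : ModuleCat.{u} Rᵐᵒᵖ) (A : ModuleCat.{u} M.TensorRingᵐᵒᵖ) :
    (M.triv.obj X ⟶ A) ≃ (X ⟶ M.kerStructureMap.obj A) where
  toFun g := kerLift ((trivIso M X).hom ≫ M.forgetT.map g) fun m x => by
    rw [ModuleCat.comp_apply, ← act_map, act_trivIso, aug_gen, MulOpposite.op_zero, zero_smul,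
      map_zero, map_zero]
  invFun f := homMk ((trivIso M X).inv ≫ f ≫ kerι A) fun m x => by
    obtain ⟨x, rfl⟩ := ((ConcreteCategory.bijective_of_isIso (trivIso M X).hom).2 x)
    rw [act_trivIso, aug_gen, MulOpposite.op_zero, zero_smul, map_zero, map_zero,
      ModuleCat.comp_apply, ModuleCat.comp_apply, act_gen_kerι]
  left_inv _ := rfl
  right_inv _ := rfl

theorem trivHomEquiv_naturality (g : M.triv.obj X ⟶ A) (h : A ⟶ B) :
    M.trivHomEquiv X B (g ≫ h) = M.trivHomEquiv X A g ≫ M.kerStructureMap.map h := rfl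

variable (M) in
/-- `ker v` is right adjoint to the trivial module functor. -/
noncomputable def trivAdj : M.triv ⊣ M.kerStructureMap :=
  Adjunction.mkOfHomEquiv
    { homEquiv := fun X A => M.trivHomEquiv X A
      homEquiv_naturality_left_symm := fun _ _ => rfl
      homEquiv_naturality_right := fun _ _ => rfl }

instance : M.triv.PreservesMonomorphisms :=
  inferInstanceAs (ModuleCat.restrictScalars (aug M).op).PreservesMonomorphisms

instance : M.forgetT.PreservesMonomorphisms :=
  inferInstanceAs (ModuleCat.restrictScalars (incl M).op).PreservesMonomorphisms

/-- A right adjoint preserves injectives when its left adjoint, here `triv`, preserves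
monomorphisms. -/
instance [Injective A] : Injective (M.kerStructureMap.obj A) :=
  Injective.injective_of_adjoint M.trivAdj A

instance [Injective X] : Injective (M.coind.obj X) :=
  Injective.injective_of_adjoint (ModuleCat.restrictCoextendScalarsAdj (incl M).op) X

end ker

end

end RingBimodule

theorem ModuleCat.shortExact_mk {S : Type*} [Ring S] {A B C : ModuleCat S} {f : A ⟶ B} {g : B ⟶ C}
    (w : f ≫ g = 0) (hf : Function.Injective f) (hg : Function.Surjective g)
    (h : ∀ b, g b = 0 → ∃ a, f a = b) : (ShortComplex.mk f g w).ShortExact where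
  exact := (ShortComplex.moduleCat_exact_iff _).2 h
  mono_f := (ModuleCat.mono_iff_injective f).2 hf
  epi_g := (ModuleCat.epi_iff_surjective g).2 hg

/-! ### Iterates of Hom(M, -) and nilpotency. -/

namespace RingBimodule

section

variable {R : Type u} [Ring R]

open TensorRing Abelian

/-- The functor `Hom(P, -)` on right `R`-modules. -/
noncomputable def homFunctor (P : RingBimodule R) :
    ModuleCat.{u} Rᵐᵒᵖ ⥤ ModuleCat.{u} Rᵐᵒᵖ where
  obj X := P.homRight X
  map {X X'} f := ModuleCat.ofHom (X := P.homRight X) (Y := P.homRight X')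
    { toFun := fun g => ofLin (f.hom.comp (toLin g))
      map_add' := fun _ _ => LinearMap.comp_add _ _ f.hom
      map_smul' := fun _ _ => rfl }
  map_id _ := rfl
  map_comp _ _ := rfl

variable (M : RingBimodule R)

instance : M.homFunctor.Additive where
  map_add {X X' f g} := by
    refine ModuleCat.hom_ext (LinearMap.ext fun h => toLin_ext fun m => ?_)
    rfl

/-- Only surjectivity on the right is not automatic, and its obstruction lies in Ext¹(M, X₁). -/
theorem shortExact_homFunctor {S : ShortComplex (ModuleCat.{u} Rᵐᵒᵖ)} (hS : S.ShortExact)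
    (h : Subsingleton (Ext M.toRight S.X₁ 1)) : (S.map M.homFunctor).ShortExact := by
  refine ModuleCat.shortExact_mk _ (fun f g hfg => toLin_ext fun m => ?_) (fun g => ?_)
    (fun g hg => ?_)
  · exact hS.moduleCat_injective_f (congrArg (fun k => toLin k m) hfg)
  · obtain ⟨ψ, hψ⟩ := hS.exists_lift_of_ext h (ModuleCat.ofHom (X := M.carrier) (toLin g))
    exact ⟨ofLin ψ.hom, toLin_ext fun m => ConcreteCategory.congr_hom hψ m⟩
  · have := hS.mono_f
    have w : ModuleCat.ofHom (X := M.carrier) (Y := S.X₂) (toLin g) ≫ S.g = 0 :=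
      ModuleCat.hom_ext (LinearMap.ext fun m => congrArg (fun k => toLin k m) hg)
    exact ⟨ofLin (hS.exact.lift _ w).hom, toLin_ext fun m =>
      ConcreteCategory.congr_hom (hS.exact.lift_f _ w) m⟩

/-- The iterates of `Hom(M, -)`. -/
noncomputable def homIterate : ℕ → ModuleCat.{u} Rᵐᵒᵖ ⥤ ModuleCat.{u} Rᵐᵒᵖ
  | 0 => 𝟭 _
  | j + 1 => M.homFunctor ⋙ homIterate j

instance homIterate_additive : ∀ j, (M.homIterate j).Additive
  | 0 => inferInstanceAs (𝟭 _ : ModuleCat.{u} Rᵐᵒᵖ ⥤ _).Additive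
  | j + 1 => by
    have := homIterate_additive j
    exact inferInstanceAs (M.homFunctor ⋙ M.homIterate j).Additive

/-- After one application of Hom(M, -) the left term is Hom(M, X₁), whose iterates are the later
iterates of X₁; so only the left term needs a hypothesis. -/
theorem shortExact_homIterate (j : ℕ) {S : ShortComplex (ModuleCat.{u} Rᵐᵒᵖ)} (hS : S.ShortExact)
    (h : ∀ i, Subsingleton (Ext M.toRight ((M.homIterate i).obj S.X₁) 1)) :
    (S.map (M.homIterate j)).ShortExact := by
  induction j generalizing S with
  | zero => exact hS
  | succ j ih => exact ih (M.shortExact_homFunctor hS (h 0)) fun i => h (i + 1)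

/-- `Hom(M, -)` applied outside or inside the iterate. -/
noncomputable def homIterateSuccIso : ∀ (j : ℕ) (X : ModuleCat.{u} Rᵐᵒᵖ),
    (M.homIterate (j + 1)).obj X ≅ M.homRight ((M.homIterate j).obj X)
  | 0, _ => Iso.refl _
  | j + 1, X => homIterateSuccIso j (M.homRight X)

variable {M}

/-- The additive map out of `M^{⊗ (i+1)}` given by a balanced biadditive map. -/
def consLift {i : ℕ} {C : Type*} [AddCommGroup C] (f : M.carrier →+ (M.pow i).carrier →+ C)
    (hf : ∀ a (r : R) x, f (op r • a) x = f a (r • x)) : (M.pow (i + 1)).carrier →+ C :=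
  BalancedTensor.lift f hf

theorem consLift_cons {i : ℕ} {C : Type*} [AddCommGroup C]
    (f : M.carrier →+ (M.pow i).carrier →+ C)
    (hf : ∀ a (r : R) x, f (op r • a) x = f a (r • x)) (a : M.carrier) (x : (M.pow i).carrier) :
    consLift f hf (cons i a x) = f a x :=
  BalancedTensor.lift_tmul f hf a x

/-- Evaluation at `1`. -/
noncomputable def homRightPowZero (X : ModuleCat.{u} Rᵐᵒᵖ) : (M.pow 0).homRight X ⟶ X :=
  ModuleCat.ofHom (X := (M.pow 0).homRight X) (Y := X)
    { toFun := fun f => toLin f (1 : R)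
      map_add' := fun _ _ => rfl
      map_smul' := fun r f => by
        have h : r.unop • (show (M.pow 0).carrier from (1 : R)) =
            r • (show (M.pow 0).carrier from (1 : R)) := by
          change r.unop * 1 = 1 * r.unop
          rw [mul_one, one_mul]
        change toLin f (r.unop • (show (M.pow 0).carrier from (1 : R))) = r • toLin f (1 : R)
        rw [h]
        exact (toLin f).map_smul r _ }

/-- Currying. -/
noncomputable def homRightPowSucc (i : ℕ) (X : ModuleCat.{u} Rᵐᵒᵖ) :
    (M.pow (i + 1)).homRight X ⟶ M.homRight ((M.pow i).homRight X) :=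
  ModuleCat.ofHom (X := (M.pow (i + 1)).homRight X) (Y := M.homRight ((M.pow i).homRight X))
    { toFun := fun f => ofLin
        { toFun := fun a => ofLin
            { toFun := fun x => toLin f (cons i a x)
              map_add' := fun x y => by rw [map_add, map_add]
              map_smul' := fun r x => by
                rw [cons_smul_right, map_smul, RingHom.id_apply] }
          map_add' := fun a b => toLin_ext fun x => by
            change toLin f (cons i (a + b) x) = toLin f (cons i a x) + toLin f (cons i b x)
            rw [map_add, AddMonoidHom.add_apply, map_add]
          map_smul' := fun r a => toLin_ext fun x => by
            change toLin f (cons i (op r.unop • a) x) = toLin f (cons i a (r.unop • x))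
            rw [cons_smul_middle] }
      map_add' := fun _ _ => rfl
      map_smul' := fun r f => toLin_ext fun a => toLin_ext fun x => by
        change toLin f (r.unop • cons i a x) = toLin f (cons i (r.unop • a) x)
        rw [cons_smul_left] }

theorem homRightPowZero_bijective (X : ModuleCat.{u} Rᵐᵒᵖ) :
    Function.Bijective (homRightPowZero (M := M) X) := by
  have key (f : (M.pow 0).homRight X) (r : R) :
      toLin f r = op r • toLin f (1 : R) := by
    refine Eq.trans (congrArg (toLin f) ?_) ((toLin f).map_smul (op r) (1 : R))
    exact (one_mul r).symm
  refine ⟨fun f g h => toLin_ext fun r => ?_, fun x => ?_⟩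
  · rw [key f r, key g r]
    exact congrArg _ h
  · exact ⟨ofLin
      { toFun := fun r => op (show R from r) • x
        map_add' := fun r s => add_smul (op (show R from r)) (op (show R from s)) x
        map_smul' := fun r s => mul_smul r (op (show R from s)) x }, one_smul _ x⟩

theorem homRightPowSucc_bijective (i : ℕ) (X : ModuleCat.{u} Rᵐᵒᵖ) :
    Function.Bijective (homRightPowSucc (M := M) i X) := by
  refine ⟨fun f g h => ?_, fun g => ?_⟩
  · exact LinearMap.toAddMonoidHom_injective (pow_succ_hom_ext fun a x =>
      congrArg (fun k => toLin (toLin k a) x) h)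
  -- Uncurrying by the universal property of the tensor product; right linearity is then checked on
  -- pure tensors.
  · let F : (M.pow (i + 1)).carrier →+ X := consLift
      (AddMonoidHom.mk' (fun a => (toLin (toLin g a)).toAddMonoidHom)
        fun a b => AddMonoidHom.ext fun x => by
          change toLin (toLin g (a + b)) x = _
          rw [map_add]
          rfl)
      fun a r x => by
        change toLin (toLin g (op r • a)) x = toLin (toLin g a) (r • x)
        rw [map_smul]
        rfl
    have hF (a x) : F (cons i a x) = toLin (toLin g a) x := consLift_cons _ _ a x
    refine ⟨ofLin { F with
      map_smul' := fun r x => DFunLike.congr_fun (pow_succ_hom_ext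
        (f := F.comp (DistribSMul.toAddMonoidHom _ r))
        (g := (DistribSMul.toAddMonoidHom _ r).comp F) fun a x => by
          change F (r • cons i a x) = r • F (cons i a x)
          rw [← cons_smul_right, hF, hF, map_smul]) x }, ?_⟩
    exact toLin_ext fun a => toLin_ext fun x => hF a x

/-- The isomorphism attached to a bijective morphism. -/
noncomputable def isoOfBijective {S : Type*} [Ring S] {A B : ModuleCat S} (f : A ⟶ B)
    (h : Function.Bijective f) : A ≅ B :=
  have := (ConcreteCategory.isIso_iff_bijective f).2 h
  asIso f

variable (M)

/-- The iterate of `Hom(M, -)` is `Hom(M^{⊗ j}, -)`. -/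
theorem nonempty_homIterateIso (j : ℕ) (X : ModuleCat.{u} Rᵐᵒᵖ) :
    Nonempty ((M.homIterate j).obj X ≅ (M.pow j).homRight X) := by
  induction j with
  | zero => exact ⟨(isoOfBijective _ (homRightPowZero_bijective X)).symm⟩
  | succ j ih =>
    obtain ⟨e⟩ := ih
    exact ⟨M.homIterateSuccIso j X ≪≫ M.homFunctor.mapIso e ≪≫
      (isoOfBijective _ (homRightPowSucc_bijective j X)).symm⟩

/-- This is the form in which nilpotency starts the descending inductions below. -/
theorem isZero_homIterate {N : ℕ} (hN : M.IsNilpotentOf N) (X : ModuleCat.{u} Rᵐᵒᵖ) :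
    IsZero ((M.homIterate (N + 1)).obj X) := by
  obtain ⟨e⟩ := M.nonempty_homIterateIso (N + 1) X
  have : Subsingleton (M.pow (N + 1)).carrier := hN
  have : Subsingleton ((M.pow (N + 1)).homRight X) :=
    ⟨fun f g => toLin_ext fun m => by rw [Subsingleton.elim m 0, map_zero, map_zero]⟩
  exact (ModuleCat.isZero_of_subsingleton _).of_iso e

end

end RingBimodule

/-! ### Coinduced modules and the sequence X → Coind(X) → Coind(Hom(M, X)). -/

namespace RingBimodule

section

variable {R : Type u} [Ring R] {M : RingBimodule R}

namespace TensorRing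

theorem pow_succ_induction {i : ℕ} {P : (M.pow (i + 1)).carrier → Prop} (zero : P 0)
    (cons : ∀ a x, P (cons i a x)) (add : ∀ x y, P x → P y → P (x + y)) (x) : P x := by
  obtain ⟨t, rfl⟩ := Submodule.Quotient.mk_surjective _ x
  induction t using TensorProduct.induction_on with
  | zero => exact zero
  | tmul a b => exact cons a b
  | add s t hs ht => exact add _ _ hs ht

theorem induction_of {P : M.TensorRing → Prop} (of : ∀ i x, P (of i x))
    (add : ∀ s t, P s → P t → P (s + t)) (t) : P t :=
  have zero : P 0 := by simpa only [map_zero] using of 0 0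
  DirectSum.induction_on t zero of add

/-- Induction on the degree, peeling off the leftmost tensor factor. -/
theorem induction {P : M.TensorRing → Prop} (incl : ∀ r, P (incl M r))
    (gen_mul : ∀ a t, P t → P (gen a * t)) (add : ∀ s t, P s → P t → P (s + t)) (t) : P t := by
  have zero : P 0 := by simpa only [map_zero] using incl 0
  refine induction_of (fun i x => ?_) add t
  induction i with
  | zero => exact incl x
  | succ i ih =>
    refine pow_succ_induction (P := fun x => P (of (i + 1) x)) (by rwa [map_zero])
      (fun a x => ?_) (fun x y hx hy => ?_) x
    · rw [of_succ_cons]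
      exact gen_mul _ _ (ih x)
    · rw [map_add]
      exact add _ _ hx hy

/-- An additive map out of `T_R(M) = R ⊕ M ⊗ T_R(M)`. -/
def liftMul {C : Type*} [AddCommGroup C] (b : R →+ C) (k : M.carrier →+ M.TensorRing →+ C)
    (hk : ∀ a (r : R) t, k (op r • a) t = k a (incl M r * t)) : M.TensorRing →+ C :=
  DirectSum.toAddMonoid (β := fun i => (M.pow i).carrier) fun i => match i with
    | 0 => b
    | i + 1 => consLift
        (AddMonoidHom.mk' (fun a => (k a).comp (of (M := M) i).toAddMonoidHom)
          fun a a' => by rw [map_add]; rfl)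
        fun a r x => by
          change k (op r • a) (of i x) = k a (of i (r • x))
          rw [hk, incl_mul, (of (M := M) i).map_smul]

theorem liftMul_incl {C : Type*} [AddCommGroup C] (b : R →+ C) (k : M.carrier →+ M.TensorRing →+ C)
    (hk : ∀ a (r : R) t, k (op r • a) t = k a (incl M r * t)) (r : R) :
    liftMul b k hk (incl M r) = b r :=
  DirectSum.toAddMonoid_of (β := fun i => (M.pow i).carrier) _ 0 r

theorem liftMul_gen_mul {C : Type*} [AddCommGroup C] (b : R →+ C)
    (k : M.carrier →+ M.TensorRing →+ C)
    (hk : ∀ a (r : R) t, k (op r • a) t = k a (incl M r * t)) (a : M.carrier) (t : M.TensorRing) :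
    liftMul b k hk (gen a * t) = k a t :=
  DFunLike.congr_fun (hom_ext (f := (liftMul b k hk).comp (AddMonoidHom.mulLeft (gen a)))
    (g := k a) fun i x => by
      change liftMul b k hk (gen a * of i x) = k a (of i x)
      rw [← of_succ_cons]
      exact (DirectSum.toAddMonoid_of (β := fun i => (M.pow i).carrier) _ (i + 1) _).trans
        (consLift_cons _ _ a x)) t

end TensorRing

open TensorRing

section coind

variable {X : ModuleCat.{u} Rᵐᵒᵖ} {A : ModuleCat.{u} M.TensorRingᵐᵒᵖ}

/-- The value of an element of `Coind(X) = Hom(T_R(M), X)`. -/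
noncomputable def coindEval (f : M.forgetT.obj (M.coind.obj X)) : M.TensorRing →+ X where
  toFun t := ModuleCat.CoextendScalars.equiv (incl M).op X f (op t)
  map_zero' := map_zero (ModuleCat.CoextendScalars.equiv (incl M).op X f)
  map_add' s t := map_add (ModuleCat.CoextendScalars.equiv (incl M).op X f) (op s) (op t)

theorem coindEval_mul_incl (f : M.forgetT.obj (M.coind.obj X)) (t : M.TensorRing) (r : R) :
    coindEval f (t * incl M r) = op r • coindEval f t :=
  (ModuleCat.CoextendScalars.equiv (incl M).op X f).map_smul (op r) (op t)

theorem coindEval_incl (f : M.forgetT.obj (M.coind.obj X)) (r : R) :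
    coindEval f (incl M r) = op r • coindEval f 1 := by
  rw [← coindEval_mul_incl, one_mul]

theorem coindEval_act (f : M.forgetT.obj (M.coind.obj X)) (s t : M.TensorRing) :
    coindEval (M.act _ s f) t = coindEval f (s * t) := rfl

theorem coindEval_add (f g : M.forgetT.obj (M.coind.obj X)) (t : M.TensorRing) :
    coindEval (f + g) t = coindEval f t + coindEval g t := rfl

theorem coindEval_zero (t : M.TensorRing) :
    coindEval (0 : M.forgetT.obj (M.coind.obj X)) t = 0 := rfl

theorem coindEval_smul (r : Rᵐᵒᵖ) (f : M.forgetT.obj (M.coind.obj X)) (t : M.TensorRing) :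
    coindEval (r • f) t = coindEval f (incl M r.unop * t) := by
  rw [← act_incl, coindEval_act]

theorem coindEval_ext {f g : M.forgetT.obj (M.coind.obj X)}
    (h : ∀ t, coindEval f t = coindEval g t) : f = g :=
  ModuleCat.CoextendScalars.ext (f := (incl M).op) (M := X) (LinearMap.ext fun t => h t.unop)

/-- A right `R`-linear map `T_R(M) → X` as an element of `Coind(X)`. -/
noncomputable def coindMk (F : M.TensorRing →+ X)
    (hF : ∀ t r, F (t * incl M r) = op r • F t) : M.forgetT.obj (M.coind.obj X) :=
  (ModuleCat.CoextendScalars.equiv (incl M).op X).symm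
    { toFun := fun t => F (unop (show M.TensorRingᵐᵒᵖ from t))
      map_add' := fun s t => map_add F (unop (show M.TensorRingᵐᵒᵖ from s))
        (unop (show M.TensorRingᵐᵒᵖ from t))
      map_smul' := fun r t => hF (unop (show M.TensorRingᵐᵒᵖ from t)) r.unop }

variable (X) in
/-- The counit `f ↦ f(1)`. -/
noncomputable def coindCounit : M.forgetT.obj (M.coind.obj X) ⟶ X :=
  (ModuleCat.restrictCoextendScalarsAdj (incl M).op).counit.app X

/-- A right `R`-linear map out of the underlying module of `A`. -/
noncomputable def forgetHomMk (f : M.forgetT.obj A →+ X)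
    (h : ∀ r y, f (M.act A (incl M r) y) = op r • f y) : M.forgetT.obj A ⟶ X :=
  ModuleCat.ofHom (X := M.forgetT.obj A) (Y := X) { f with map_smul' := fun r y => h r.unop y }

/-- The map `A → Coind(X)` adjoint to `U(A) → X`. -/
noncomputable def coindLift (φ : M.forgetT.obj A ⟶ X) : A ⟶ M.coind.obj X :=
  ModuleCat.RestrictionCoextensionAdj.HomEquiv.fromRestriction (incl M).op φ

theorem coindEval_coindLift (φ : M.forgetT.obj A ⟶ X) (y : M.forgetT.obj A) (t : M.TensorRing) :
    coindEval (M.forgetT.map (coindLift φ) y) t = φ (M.act A t y) := rfl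

/-- As T = R ⊕ (M ⊗ T), a family h : M → Coind(X) is the same as a map on M ⊗ T; extending it by
zero on R gives a preimage. -/
theorem coind_structureMap_surjective (X : ModuleCat.{u} Rᵐᵒᵖ) :
    Function.Surjective (M.structureMap (M.coind.obj X)) := by
  intro h
  let F : M.TensorRing →+ X := liftMul 0
    (AddMonoidHom.mk' (fun a => coindEval (toLin h a)) fun a b => by
      rw [map_add]
      rfl)
    fun a r t => by
      change coindEval (toLin h (op r • a)) t = coindEval (toLin h a) (incl M r * t)
      rw [map_smul, coindEval_smul, unop_op]
  have hF0 (r) : F (incl M r) = 0 := liftMul_incl _ _ _ r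
  have hF (a t) : F (gen a * t) = coindEval (toLin h a) t := liftMul_gen_mul _ _ _ a t
  refine ⟨coindMk F fun t r => ?_, toLin_ext fun a => coindEval_ext fun t => hF a t⟩
  induction t using TensorRing.induction with
  | incl s => rw [← map_mul, hF0, hF0, smul_zero]
  | gen_mul a t ih => rw [mul_assoc, hF, hF, coindEval_mul_incl]
  | add s t hs ht => rw [add_mul, map_add, map_add, hs, ht, smul_add]

variable (M) in
-- An f annihilated by M vanishes on M · T, so f(1) determines it. Conversely x comes from t ↦ x ·
-- aug(t).
theorem kerι_coindCounit_bijective (X : ModuleCat.{u} Rᵐᵒᵖ) :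
    Function.Bijective (kerι (M.coind.obj X) ≫ coindCounit X) := by
  constructor
  · rw [injective_iff_map_eq_zero]
    intro f hf
    refine kerι_injective ((coindEval_ext fun t => ?_).trans (map_zero _).symm)
    have hf : coindEval (kerι (M.coind.obj X) f) 1 = 0 := hf
    rw [coindEval_zero]
    induction t using TensorRing.induction with
    | incl s => rw [coindEval_incl, hf, smul_zero]
    | gen_mul a t ih => rw [← coindEval_act, act_gen_kerι, coindEval_zero]
    | add s t hs ht => rw [map_add, hs, ht, add_zero]
  · intro x
    let F : M.TensorRing →+ X := AddMonoidHom.mk' (fun t => op (aug M t) • x) fun s t => by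
      rw [map_add, MulOpposite.op_add, add_smul]
    obtain ⟨f, hf⟩ := exists_kerι_eq (A := M.coind.obj X)
      (y := coindMk F fun t r => by
        change op (aug M (t * incl M r)) • x = op r • op (aug M t) • x
        rw [map_mul, aug_incl, op_mul, mul_smul])
      fun m => coindEval_ext fun t => by
        change op (aug M (gen m * t)) • x = 0
        rw [aug_gen_mul, MulOpposite.op_zero, zero_smul]
    refine ⟨f, ?_⟩
    rw [ModuleCat.comp_apply, hf]
    change op (aug M 1) • x = x
    rw [map_one, op_one, one_smul]

variable (M) in
/-- `ker v ≅ X` for `[Y, v] = Coind(X)`. -/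
noncomputable def kerCoindIso (X : ModuleCat.{u} Rᵐᵒᵖ) :
    M.kerStructureMap.obj (M.coind.obj X) ≅ X :=
  isoOfBijective _ (M.kerι_coindCounit_bijective X)

variable (M) in
/-- The inclusion of the trivial module `X` in `Coind(X)`. -/
noncomputable def trivToCoind (X : ModuleCat.{u} Rᵐᵒᵖ) : M.triv.obj X ⟶ M.coind.obj X :=
  (M.trivHomEquiv X _).symm (M.kerCoindIso X).inv

variable (M) in
/-- The map `Coind(X) → Coind(Hom(M, X))`, sending `f` to `t ↦ (m ↦ f(t m))`. -/
noncomputable def coindToCoind (X : ModuleCat.{u} Rᵐᵒᵖ) :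
    M.coind.obj X ⟶ M.coind.obj (M.homRight X) :=
  coindLift (forgetHomMk (A := M.coind.obj X) (X := M.homRight X)
    (AddMonoidHom.mk' (fun f => ofLin
        { toFun := fun m => coindEval f (gen m)
          map_add' := fun m n => by rw [map_add, map_add]
          map_smul' := fun r m => by
            rw [RingHom.id_apply, ← op_unop r, ← gen_mul_incl, coindEval_mul_incl] })
      fun _ _ => rfl)
    fun r f => toLin_ext fun m => by
      change coindEval (M.act _ (incl M r) f) (gen m) = coindEval f (gen (r • m))
      rw [coindEval_act, incl_mul_gen])

/-- The additive maps `M^{⊗ i} → Hom_ℤ(Coind(Hom(M, X)), X)` compatible with the left action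
of `R`. -/
def CoindSectionComponent (M : RingBimodule R) (X : ModuleCat.{u} Rᵐᵒᵖ) (i : ℕ) : Type u :=
  {σ : (M.pow i).carrier →+ (M.forgetT.obj (M.coind.obj (M.homRight X)) →+ X) //
    ∀ (s : R) x h, σ (s • x) h = σ x (M.act _ (incl M s) h)}

/-- The biadditive map inducing the next component of a section of `coindToCoind`. -/
noncomputable def coindSectionStepAux {i : ℕ} (σ : CoindSectionComponent M X i) :
    M.carrier →+ (M.pow i).carrier →+ (M.forgetT.obj (M.coind.obj (M.homRight X)) →+ X) :=
  AddMonoidHom.mk' (fun a => AddMonoidHom.mk' (fun x => AddMonoidHom.mk' (fun h =>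
    -- The aim is σ(t m)(h) = h(t)(m), with σ = 0 on R. For x in R one has a x = 1 · (a x), which
    -- gives the first term; for x = t m one has h(a t)(m) = (h · a)(t)(m), which gives the second.
    -- The augmentation kills the first term in positive degree, and σ = 0 on R kills the second in
    -- degree 0.
    toLin (coindEval h 1) (op (aug M (of i x)) • a) + σ.1 x (M.act _ (gen a) h))
    (fun h h' => by
      rw [coindEval_add, toLin_add, map_add, map_add]
      abel))
    (fun x y => AddMonoidHom.ext fun h => by
      change toLin (coindEval h 1) (op (aug M (of i (x + y))) • a) +
        σ.1 (x + y) (M.act _ (gen a) h) =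
        (toLin (coindEval h 1) (op (aug M (of i x)) • a) + σ.1 x (M.act _ (gen a) h)) +
        (toLin (coindEval h 1) (op (aug M (of i y)) • a) + σ.1 y (M.act _ (gen a) h))
      rw [map_add, map_add, MulOpposite.op_add, add_smul, map_add, map_add,
        AddMonoidHom.add_apply]
      abel))
    (fun a b => AddMonoidHom.ext fun x => AddMonoidHom.ext fun h => by
      change toLin (coindEval h 1) (op (aug M (of i x)) • (a + b)) +
        σ.1 x (M.act _ (gen (a + b)) h) =
        (toLin (coindEval h 1) (op (aug M (of i x)) • a) + σ.1 x (M.act _ (gen a) h)) +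
        (toLin (coindEval h 1) (op (aug M (of i x)) • b) + σ.1 x (M.act _ (gen b) h))
      rw [smul_add, map_add, map_add, act_add, map_add]
      abel)

theorem coindSectionStepAux_apply {i : ℕ} (σ : CoindSectionComponent M X i) (a : M.carrier)
    (x : (M.pow i).carrier) (h : M.forgetT.obj (M.coind.obj (M.homRight X))) :
    coindSectionStepAux σ a x h =
      toLin (coindEval h 1) (op (aug M (of i x)) • a) + σ.1 x (M.act _ (gen a) h) := rfl

theorem coindSectionStepAux_balanced {i : ℕ} (σ : CoindSectionComponent M X i) (a : M.carrier)
    (r : R) (x : (M.pow i).carrier) :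
    coindSectionStepAux σ (op r • a) x = coindSectionStepAux σ a (r • x) :=
  AddMonoidHom.ext fun h => by
    rw [coindSectionStepAux_apply, coindSectionStepAux_apply, ← gen_mul_incl, act_mul, ← σ.2,
      (of (M := M) i).map_smul, ← incl_mul, map_mul, aug_incl, op_mul, mul_smul]

/-- The next component of a section of `coindToCoind`. -/
noncomputable def coindSectionStep {i : ℕ} (σ : CoindSectionComponent M X i) :
    CoindSectionComponent M X (i + 1) :=
  ⟨consLift _ (coindSectionStepAux_balanced σ),
    fun s x h => DFunLike.congr_fun (pow_succ_hom_ext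
      (f := (AddMonoidHom.eval h).comp ((consLift _ (coindSectionStepAux_balanced σ)).comp
        (DistribSMul.toAddMonoidHom _ s)))
      (g := (AddMonoidHom.eval (M.act _ (incl M s) h)).comp
        (consLift _ (coindSectionStepAux_balanced σ))) fun a x => by
        change consLift _ (coindSectionStepAux_balanced σ) (s • cons i a x) h =
          consLift _ (coindSectionStepAux_balanced σ) (cons i a x) (M.act _ (incl M s) h)
        rw [← cons_smul_left, consLift_cons, consLift_cons, coindSectionStepAux_apply,
          coindSectionStepAux_apply, ← act_mul, incl_mul_gen,
          coindEval_act, mul_one, coindEval_incl, toLin_smul, unop_op, smul_comm s]) x⟩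

/-- The components of a section of `coindToCoind`. -/
noncomputable def coindSectionAux (X : ModuleCat.{u} Rᵐᵒᵖ) : ∀ i : ℕ, CoindSectionComponent M X i
  | 0 => ⟨0, fun _ _ _ => rfl⟩
  | i + 1 => coindSectionStep (coindSectionAux X i)

theorem coindSectionAux_cons (i : ℕ) (a : M.carrier) (x : (M.pow i).carrier)
    (h : M.forgetT.obj (M.coind.obj (M.homRight X))) :
    (coindSectionAux X (i + 1)).1 (cons i a x) h =
      toLin (coindEval h 1) (op (aug M (of i x)) • a) +
        (coindSectionAux X i).1 x (M.act _ (gen a) h) :=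
  DFunLike.congr_fun (consLift_cons _ (coindSectionStepAux_balanced (coindSectionAux X i)) a x) h

/-- A section of `coindToCoind`, with the arguments swapped. -/
noncomputable def coindSection (X : ModuleCat.{u} Rᵐᵒᵖ) :
    M.TensorRing →+ (M.forgetT.obj (M.coind.obj (M.homRight X)) →+ X) :=
  DirectSum.toAddMonoid (β := fun i => (M.pow i).carrier) fun i => (coindSectionAux X i).1

theorem coindSection_of (i : ℕ) (x : (M.pow i).carrier) :
    coindSection X (of i x) = (coindSectionAux X i).1 x :=
  DirectSum.toAddMonoid_of (β := fun i => (M.pow i).carrier) _ i x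

theorem coindSection_incl (r : R) : coindSection X (incl M r) = 0 :=
  coindSection_of (X := X) 0 r

theorem coindSection_gen_mul (a : M.carrier) (t : M.TensorRing)
    (h : M.forgetT.obj (M.coind.obj (M.homRight X))) :
    coindSection X (gen a * t) h =
      toLin (coindEval h 1) (op (aug M t) • a) + coindSection X t (M.act _ (gen a) h) := by
  induction t using TensorRing.induction_of with
  | of i x => rw [← of_succ_cons, coindSection_of, coindSection_of, coindSectionAux_cons]
  | add s t hs ht =>
    rw [mul_add, map_add, AddMonoidHom.add_apply, hs, ht, map_add, MulOpposite.op_add, add_smul,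
      map_add, map_add, AddMonoidHom.add_apply]
    abel

/-- The defining property of the section: the recursion peels factors off the left, yet the result
reads off the rightmost factor. -/
theorem coindSection_mul_gen (t : M.TensorRing) (m : M.carrier)
    (h : M.forgetT.obj (M.coind.obj (M.homRight X))) :
    coindSection X (t * gen m) h = toLin (coindEval h t) m := by
  induction t using TensorRing.induction generalizing h with
  | incl r =>
    rw [incl_mul_gen, ← mul_one (gen _), coindSection_gen_mul, map_one (aug M), op_one, one_smul,
      ← map_one (incl M), coindSection_incl, AddMonoidHom.zero_apply, add_zero, map_one (incl M),
      coindEval_incl, toLin_smul, unop_op]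
  | gen_mul a t ih =>
    rw [mul_assoc, coindSection_gen_mul, ih, map_mul, aug_gen, mul_zero, MulOpposite.op_zero,
      zero_smul, map_zero, zero_add, coindEval_act]
  | add s t hs ht =>
    rw [add_mul, map_add, AddMonoidHom.add_apply, hs, ht, map_add, toLin_add]

theorem coindSection_mul_incl (t : M.TensorRing) (r : R)
    (h : M.forgetT.obj (M.coind.obj (M.homRight X))) :
    coindSection X (t * incl M r) h = op r • coindSection X t h := by
  induction t using TensorRing.induction generalizing h with
  | incl s =>
    rw [← map_mul, coindSection_incl, coindSection_incl, AddMonoidHom.zero_apply, smul_zero]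
  | gen_mul a t ih =>
    rw [mul_assoc, coindSection_gen_mul, coindSection_gen_mul, ih, map_mul, aug_incl, op_mul,
      mul_smul, smul_add, map_smul]
  | add s t hs ht =>
    rw [add_mul, map_add, AddMonoidHom.add_apply, hs, ht, map_add, AddMonoidHom.add_apply, smul_add]

/-- A preimage of h is h on T ⊗ M extended by zero on R. The powers of M grow on the left, so the
decomposition T = R ⊕ (T ⊗ M) is not visible by definition and `coindSection` replaces it. -/
theorem coindToCoind_surjective (X : ModuleCat.{u} Rᵐᵒᵖ) :
    Function.Surjective (M.coindToCoind X) := by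
  intro h
  let F : M.TensorRing →+ X :=
    (AddMonoidHom.eval (show M.forgetT.obj (M.coind.obj (M.homRight X)) from h)).comp
      (coindSection X)
  refine ⟨coindMk F fun t r => coindSection_mul_incl t r _, ?_⟩
  exact coindEval_ext fun t => toLin_ext fun m => coindSection_mul_gen t m _

/-- T · M and M · T are the same ideal of positive degree. The induction generalizes F so that the
leading factor can be absorbed into it. -/
theorem eq_zero_of_mul_gen {C : Type*} [AddCommGroup C] {F : M.TensorRing →+ C}
    (hF : ∀ t m, F (t * gen m) = 0) (a : M.carrier) (t : M.TensorRing) : F (gen a * t) = 0 := by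
  induction t using TensorRing.induction generalizing F a with
  | incl r => rw [gen_mul_incl, ← one_mul (gen _), hF]
  | gen_mul b t ih =>
    exact ih (F := F.comp (AddMonoidHom.mulLeft (gen a))) (fun t m => by
      change F (gen a * (t * gen m)) = 0
      rw [← mul_assoc, hF]) b
  | add s t hs ht => rw [mul_add, map_add, hs hF, ht hF, add_zero]

theorem trivToCoind_coindToCoind (X : ModuleCat.{u} Rᵐᵒᵖ) :
    M.trivToCoind X ≫ M.coindToCoind X = 0 := by
  refine ModuleCat.hom_ext (LinearMap.ext fun x => coindEval_ext fun t => toLin_ext fun m => ?_)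
  change coindEval (kerι (M.coind.obj X) ((M.kerCoindIso X).inv x)) (t * gen m) = 0
  induction t using TensorRing.induction with
  | incl r => rw [incl_mul_gen, ← mul_one (gen _), ← coindEval_act, act_gen_kerι, coindEval_zero]
  | gen_mul a t ih => rw [mul_assoc, ← coindEval_act, act_gen_kerι, coindEval_zero]
  | add s t hs ht => rw [add_mul, map_add, hs, ht, add_zero]

variable (M) in
/-- The exact sequence `0 → X → Coind(X) → Coind(Hom(M, X)) → 0`, with `M` acting trivially
on `X`. -/
theorem shortExact_coind (X : ModuleCat.{u} Rᵐᵒᵖ) :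
    (ShortComplex.mk _ _ (trivToCoind_coindToCoind (M := M) X)).ShortExact := by
  refine ModuleCat.shortExact_mk _ ?_ (coindToCoind_surjective X) fun f hf => ?_
  · exact kerι_injective.comp (ConcreteCategory.bijective_of_isIso (M.kerCoindIso X).inv).1
  -- The kernel consists of the f vanishing on T · M, hence on M · T, and these are the elements of
  -- ker v.
  · have hf' (t m) : coindEval (X := X) f (t * gen m) = 0 :=
      congrArg (fun k => toLin (coindEval (X := M.homRight X) k t) m) hf
    obtain ⟨z, hz⟩ := exists_kerι_eq (A := M.coind.obj X) (y := f)
      fun m => coindEval_ext fun t => eq_zero_of_mul_gen hf' m t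
    refine ⟨(M.kerCoindIso X).hom z, ?_⟩
    rw [← hz]
    exact congrArg (kerι (M.coind.obj X)) ((M.kerCoindIso X).hom_inv_id_apply z)

end coind

/-! ### Surjectivity of v and exactness of ker v. -/

section structureMap

variable {A E C : ModuleCat.{u} M.TensorRingᵐᵒᵖ}

theorem exists_act_gen_eq (hA : Function.Surjective (M.structureMap A))
    (φ : M.toRight ⟶ M.forgetT.obj A) : ∃ y, ∀ m, M.act A (gen m) y = φ m := by
  obtain ⟨y, hy⟩ := hA (ofLin φ.hom)
  exact ⟨y, fun m => congrArg (fun k => toLin k m) hy⟩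

theorem structureMap_surjective_of_forall
    (h : ∀ φ : M.toRight ⟶ M.forgetT.obj A, ∃ y, ∀ m, M.act A (gen m) y = φ m) :
    Function.Surjective (M.structureMap A) := fun f => by
  obtain ⟨y, hy⟩ := h (ModuleCat.ofHom (X := M.carrier) (Y := M.forgetT.obj A) (toLin f))
  exact ⟨y, toLin_ext hy⟩

/-- E is a retract of Coind(U E), and surjectivity of v passes to retracts. -/
theorem structureMap_surjective_of_injective (E : ModuleCat.{u} M.TensorRingᵐᵒᵖ) [Injective E] :
    Function.Surjective (M.structureMap E) := by
  let η : E ⟶ M.coind.obj (M.forgetT.obj E) := coindLift (𝟙 _)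
  have hη : Mono η := (ModuleCat.mono_iff_injective η).2 fun x y h => by
    have := congrArg (fun k => coindEval (X := M.forgetT.obj E) k 1) h
    rwa [show coindEval (X := M.forgetT.obj E) (η x) 1 = x from one_smul _ x,
      show coindEval (X := M.forgetT.obj E) (η y) 1 = y from one_smul _ y] at this
  have hr := Injective.comp_factorThru (𝟙 E) η
  refine structureMap_surjective_of_forall fun φ => ?_
  obtain ⟨y, hy⟩ := exists_act_gen_eq (coind_structureMap_surjective _) (φ ≫ M.forgetT.map η)
  refine ⟨M.forgetT.map (Injective.factorThru (𝟙 E) η) y, fun m => ?_⟩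
  rw [← act_map, hy]
  exact ConcreteCategory.congr_hom hr (φ m)

instance : M.kerStructureMap.Additive where
  map_add := rfl

theorem shortExact_forgetT {S : ShortComplex (ModuleCat.{u} M.TensorRingᵐᵒᵖ)}
    (hS : S.ShortExact) : (S.map M.forgetT).ShortExact :=
  ModuleCat.shortExact_mk _ hS.moduleCat_injective_f hS.moduleCat_surjective_g
    ((ShortComplex.moduleCat_exact_iff S).1 hS.exact)

/-- Snake lemma for the three structure maps: K is left exact, and the obstruction to lifting an
element of K(X₃) lies in the cokernel of v on X₁. -/
theorem shortExact_kerStructureMap {S : ShortComplex (ModuleCat.{u} M.TensorRingᵐᵒᵖ)}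
    (hS : S.ShortExact) (h : Function.Surjective (M.structureMap S.X₁)) :
    (S.map M.kerStructureMap).ShortExact := by
  have hS' := shortExact_forgetT hS
  have hf : Function.Injective (M.forgetT.map S.f) := hS'.moduleCat_injective_f
  have hex : ∀ x, M.forgetT.map S.g x = 0 → ∃ y, M.forgetT.map S.f y = x :=
    (ShortComplex.moduleCat_exact_iff (S.map M.forgetT)).1 hS'.exact
  have hw : ∀ y, M.forgetT.map S.g (M.forgetT.map S.f y) = 0 :=
    fun y => ConcreteCategory.congr_hom S.zero y
  refine ModuleCat.shortExact_mk _ (fun x y hxy => ?_) (fun c => ?_) (fun e he => ?_)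
  · exact kerι_injective (hf (congrArg (kerι S.X₂) hxy))
  · obtain ⟨e, he⟩ : ∃ e, M.forgetT.map S.g e = kerι S.X₃ c :=
      hS'.moduleCat_surjective_g (kerι S.X₃ c)
    -- For a lift e of c, the map m ↦ e · m lands in X₁, so it is the action on some a in X₁; then e
    -- - a lies in ker v and still lifts c.
    have w : (ModuleCat.ofHom (X := M.carrier) (Y := M.forgetT.obj S.X₂)
        (toLin (M.structureMap S.X₂ e)) : M.toRight ⟶ M.forgetT.obj S.X₂) ≫
          M.forgetT.map S.g = 0 :=
      ModuleCat.hom_ext (LinearMap.ext fun m => by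
        change M.forgetT.map S.g (M.act S.X₂ (gen m) e) = 0
        rw [act_map, he, act_gen_kerι])
    have := hS'.mono_f
    obtain ⟨a, ha⟩ := exists_act_gen_eq h (hS'.exact.lift _ w)
    obtain ⟨z, hz⟩ := exists_kerι_eq (y := e - M.forgetT.map S.f a) fun m => by
      rw [map_sub, ← act_map, ha]
      exact sub_eq_zero.2 (ConcreteCategory.congr_hom (hS'.exact.lift_f _ w) m).symm
    refine ⟨z, kerι_injective ?_⟩
    change M.forgetT.map S.g (kerι S.X₂ z) = kerι S.X₃ c
    rw [hz, map_sub, hw, sub_zero, he]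
  · have he : M.forgetT.map S.g (kerι S.X₂ e) = 0 := congrArg (kerι S.X₃) he
    obtain ⟨a, ha⟩ := hex _ he
    obtain ⟨z, hz⟩ := exists_kerι_eq (y := a) fun m => hf (by
      rw [act_map, ha, act_gen_kerι, map_zero])
    refine ⟨z, kerι_injective ?_⟩
    change M.forgetT.map S.f (kerι S.X₁ z) = kerι S.X₂ e
    rw [hz, ha]

end structureMap

end

end RingBimodule

/-! ### Comparison of short exact sequences and of Hom complexes. -/

section

variable {C : Type*} [Category C] [Abelian C]

theorem CategoryTheory.ShortComplex.ShortExact.nonempty_iso_X₃ {S S' : ShortComplex C}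
    (hS : S.ShortExact) (hS' : S'.ShortExact) (e₁ : S.X₁ ≅ S'.X₁) (e₂ : S.X₂ ≅ S'.X₂)
    (w : S.f ≫ e₂.hom = e₁.hom ≫ S'.f) : Nonempty (S.X₃ ≅ S'.X₃) := by
  have := hS.epi_g
  have := hS'.epi_g
  exact ⟨(hS.gIsCokernel.coconePointUniqueUpToIso (colimit.isColimit _)) ≪≫
    cokernel.mapIso S.f S'.f e₁ e₂ w ≪≫
    (hS'.gIsCokernel.coconePointUniqueUpToIso (colimit.isColimit _)).symm⟩

theorem CategoryTheory.ShortComplex.ShortExact.nonempty_iso_X₁ {S S' : ShortComplex C}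
    (hS : S.ShortExact) (hS' : S'.ShortExact) (e₂ : S.X₂ ≅ S'.X₂) (e₃ : S.X₃ ≅ S'.X₃)
    (w : S.g ≫ e₃.hom = e₂.hom ≫ S'.g) : Nonempty (S.X₁ ≅ S'.X₁) := by
  have := hS.mono_f
  have := hS'.mono_f
  exact ⟨(hS.fIsKernel.conePointUniqueUpToIso (limit.isLimit _)) ≪≫
    kernel.mapIso S.g S'.g e₂ e₃ w ≪≫
    (hS'.fIsKernel.conePointUniqueUpToIso (limit.isLimit _)).symm⟩

/-- If `0 → W' → W → W'' → 0` is exact, `I` is a complex of injectives, and `Hom(W, I)` and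
`Hom(W'', I)` are exact, then `Hom(W', I)` is exact. -/
theorem homFrom_acyclic_of_shortExact {S : ShortComplex C} (hS : S.ShortExact)
    {I : CochainComplex C ℤ} (hI : ∀ n, Injective (I.X n)) (h₂ : (homFrom S.X₂ I).Acyclic)
    (h₃ : (homFrom S.X₃ I).Acyclic) : (homFrom S.X₁ I).Acyclic := by
  have := hS.mono_f
  have := hS.epi_g
  rw [homFrom_acyclic_iff] at *
  intro n x hx
  let x' : S.X₂ ⟶ I.X (n + 1) := Injective.factorThru x S.f
  have hx' : S.f ≫ x' = x := Injective.comp_factorThru x S.f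
  have h0 : S.f ≫ x' ≫ I.d (n + 1) (n + 1 + 1) = 0 := by rw [reassoc_of% hx', hx]
  let w := hS.exact.desc (x' ≫ I.d (n + 1) (n + 1 + 1)) h0
  have hw : S.g ≫ w = x' ≫ I.d (n + 1) (n + 1 + 1) := hS.exact.g_desc _ h0
  -- The differential of the extension x' factors through W'' as a cocycle w. Writing w as a
  -- coboundary corrects x' to a cocycle on W without changing its restriction to W'.
  obtain ⟨w', hw'⟩ := h₃ (n + 1) w (by
    rw [← cancel_epi S.g, reassoc_of% hw, HomologicalComplex.d_comp_d, comp_zero, comp_zero])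
  obtain ⟨y, hy⟩ := h₂ n (x' - S.g ≫ w') (by
    rw [Preadditive.sub_comp, Category.assoc, hw', hw, sub_self])
  refine ⟨S.f ≫ y, ?_⟩
  rw [Category.assoc, hy, Preadditive.comp_sub, hx', reassoc_of% S.zero, zero_comp, sub_zero]

end

/-! ### Ext vanishing for triv and Coind. -/

namespace RingBimodule

section

variable {R : Type u} [Ring R] {M : RingBimodule R}

open TensorRing Abelian

variable {A : ModuleCat.{u} M.TensorRingᵐᵒᵖ} {Y : ObjectProperty (ModuleCat.{u} Rᵐᵒᵖ)}

theorem psi_iff (Z : ObjectProperty (ModuleCat.{u} Rᵐᵒᵖ)) (A : ModuleCat.{u} M.TensorRingᵐᵒᵖ) :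
    M.psi Z A ↔ Function.Surjective (M.structureMap A) ∧ Z (kernel (M.structureMap A)) := by
  rw [← ModuleCat.epi_iff_surjective]
  rfl

theorem psi_gorensteinInjective_iff (A : ModuleCat.{u} M.TensorRingᵐᵒᵖ) :
    M.psi (gorensteinInjective Y) A ↔ Function.Surjective (M.structureMap A) ∧
      gorensteinInjective Y (M.kerStructureMap.obj A) := by
  rw [psi_iff]
  exact and_congr_right fun _ => ⟨fun h => h.congr (kernelStructureMapIso A),
    fun h => h.congr (kernelStructureMapIso A).symm⟩

/-- Embed A in an injective. Lifting from triv X along the quotient map is, by adjunction, lifting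
from X along its image under K, whose kernel is K(A). -/
theorem subsingleton_ext_triv (hA : Function.Surjective (M.structureMap A))
    {X : ModuleCat.{u} Rᵐᵒᵖ} (h : Subsingleton (Ext X (M.kerStructureMap.obj A) 1)) :
    Subsingleton (Ext (M.triv.obj X) A 1) := by
  let S : ShortComplex (ModuleCat.{u} M.TensorRingᵐᵒᵖ) :=
    ShortComplex.mk (Injective.ι A) (cokernel.π (Injective.ι A)) (cokernel.condition _)
  have hS : S.ShortExact :=
    { exact := ShortComplex.exact_cokernel _
      mono_f := inferInstanceAs (Mono (Injective.ι A))
      epi_g := inferInstanceAs (Epi (cokernel.π (Injective.ι A))) }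
  have : Injective S.X₂ := inferInstanceAs (Injective (Injective.under A))
  refine hS.subsingleton_ext_of_lift fun φ => ?_
  obtain ⟨ψ, hψ⟩ := (shortExact_kerStructureMap hS hA).exists_lift_of_ext h (M.trivHomEquiv X _ φ)
  refine ⟨(M.trivHomEquiv X _).symm ψ, (M.trivHomEquiv X _).injective ?_⟩
  rw [trivHomEquiv_naturality]
  exact (congrArg (· ≫ M.kerStructureMap.map S.g)
    ((M.trivHomEquiv X S.X₂).apply_symm_apply ψ)).trans hψ

theorem isZero_coind {X : ModuleCat.{u} Rᵐᵒᵖ} (hX : IsZero X) : IsZero (M.coind.obj X) := by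
  have := ModuleCat.subsingleton_of_isZero hX
  have : Subsingleton (M.coind.obj X) := ⟨fun f g => coindEval_ext fun t => Subsingleton.elim _ _⟩
  exact ModuleCat.isZero_of_subsingleton _

/-- Dévissage by `shortExact_coind`: the factors of Coind(X) are the trivial modules on the iterates
Hom(M, -)^i X, finitely many as the n-th is zero. -/
theorem subsingleton_ext_coind (hA : Function.Surjective (M.structureMap A)) (n : ℕ)
    {X : ModuleCat.{u} Rᵐᵒᵖ} (hX : IsZero ((M.homIterate n).obj X))
    (h : ∀ i, Subsingleton (Ext ((M.homIterate i).obj X) (M.kerStructureMap.obj A) 1)) :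
    Subsingleton (Ext (M.coind.obj X) A 1) := by
  induction n generalizing X with
  | zero => exact Ext.subsingleton_of_isZero' (isZero_coind hX)
  | succ n ih =>
    exact (M.shortExact_coind X).subsingleton_ext_middle' (subsingleton_ext_triv hA (h 0))
      (ih (X := M.homRight X) hX fun i => h (i + 1))

theorem kerι_structureMap (A : ModuleCat.{u} M.TensorRingᵐᵒᵖ) :
    kerι A ≫ M.structureMap A = 0 :=
  ModuleCat.hom_ext (LinearMap.ext fun y => toLin_ext fun m => act_gen_kerι m y)

variable (M) in
/-- The short complex `ker v → Y → Hom(M, Y)`. -/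
noncomputable def structureComplex (A : ModuleCat.{u} M.TensorRingᵐᵒᵖ) :
    ShortComplex (ModuleCat.{u} Rᵐᵒᵖ) :=
  ShortComplex.mk _ _ (kerι_structureMap A)

theorem shortExact_structureComplex (hA : Function.Surjective (M.structureMap A)) :
    (M.structureComplex A).ShortExact :=
  ModuleCat.shortExact_mk _ kerι_injective hA fun _ hy =>
    exists_kerι_eq (structureMap_eq_zero_iff.1 hy)

variable (M) in
/-- `structureComplex` is functorial. -/
noncomputable def structureComplexMap {A B : ModuleCat.{u} M.TensorRingᵐᵒᵖ} (g : A ⟶ B) :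
    M.structureComplex A ⟶ M.structureComplex B where
  τ₁ := M.kerStructureMap.map g
  τ₂ := M.forgetT.map g
  τ₃ := M.homFunctor.map (M.forgetT.map g)
  comm₂₃ := ModuleCat.hom_ext (LinearMap.ext fun y => toLin_ext fun m =>
    (act_map g (gen m) y).symm)

theorem IsCoadmissible.subsingleton_ext_homIterate (h : M.IsCoadmissible Y)
    {H B : ModuleCat.{u} Rᵐᵒᵖ} (hH : gorensteinInjective Y H) (hB : Y B) (i : ℕ) :
    Subsingleton (Ext ((M.homIterate i).obj B) H 1) := by
  obtain ⟨e⟩ := M.nonempty_homIterateIso i B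
  exact Ext.subsingleton_congr e.symm (Iso.refl _) (h.ext_hom_pow H hH B hB i)

theorem IsCoadmissible.subsingleton_ext_toRight (h : M.IsCoadmissible Y)
    {H : ModuleCat.{u} Rᵐᵒᵖ} (hH : gorensteinInjective Y H) (i : ℕ) :
    Subsingleton (Ext M.toRight ((M.homIterate i).obj H) 1) := by
  obtain ⟨e⟩ := M.nonempty_homIterateIso i H
  exact Ext.subsingleton_congr (Iso.refl _) e.symm (h.ext_pow_hom H hH i)

/-! ### Consequences of co-admissibility and nilpotency. -/

section coadmissible

variable {N : ℕ} (hN : M.IsNilpotentOf N) (hadm : M.IsCoadmissible Y)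

include hN hadm

theorem subsingleton_ext_coind_of_coadmissible (hA : Function.Surjective (M.structureMap A))
    (hK : gorensteinInjective Y (M.kerStructureMap.obj A)) {B : ModuleCat.{u} Rᵐᵒᵖ} (hB : Y B) :
    Subsingleton (Ext (M.coind.obj B) A 1) :=
  subsingleton_ext_coind hA (N + 1) (M.isZero_homIterate hN B) fun i =>
    hadm.subsingleton_ext_homIterate hK hB i

theorem subsingleton_ext_coind_homRight_of_coadmissible
    (hA : Function.Surjective (M.structureMap A))
    (hK : gorensteinInjective Y (M.kerStructureMap.obj A)) {B : ModuleCat.{u} Rᵐᵒᵖ} (hB : Y B) :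
    Subsingleton (Ext (M.coind.obj (M.homRight B)) A 1) :=
  subsingleton_ext_coind hA (N + 1) (M.isZero_homIterate hN _) fun i =>
    hadm.subsingleton_ext_homIterate hK hB (i + 1)

/-- Apply Hom(M, -)^j to 0 → K(A) → UA → Hom(M, UA) → 0. The right term is the next iterate of UA,
so descending induction from the zero iterate at N + 1 reaches j = 0. -/
theorem subsingleton_ext_toRight_forgetT (hA : Function.Surjective (M.structureMap A))
    (hK : gorensteinInjective Y (M.kerStructureMap.obj A)) :
    Subsingleton (Ext M.toRight (M.forgetT.obj A) 1) := by
  have hK' := fun i => hadm.subsingleton_ext_toRight hK i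
  have key : ∀ k j, j + k = N + 1 →
      Subsingleton (Ext M.toRight ((M.homIterate j).obj (M.forgetT.obj A)) 1) := by
    intro k
    induction k with
    | zero =>
      rintro _ rfl
      exact Ext.subsingleton_of_isZero (M.isZero_homIterate hN _)
    | succ k ih =>
      intro j hj
      exact (M.shortExact_homIterate j (shortExact_structureComplex hA) hK').subsingleton_ext_middle
        (hK' j) (ih (j + 1) (by omega))
  exact key (N + 1) 0 (by omega)

/-- The same descending induction for a morphism: the structure sequences stay exact under Hom(M,
-)^j, and the four lemma gives the middle map from the outer two. -/
theorem epi_homIterate_map {E : ModuleCat.{u} M.TensorRingᵐᵒᵖ}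
    (hE : Function.Surjective (M.structureMap E))
    (hKE : gorensteinInjective Y (M.kerStructureMap.obj E))
    (hA : Function.Surjective (M.structureMap A))
    (hK : gorensteinInjective Y (M.kerStructureMap.obj A)) (g : E ⟶ A)
    (hg : ∀ j, Epi ((M.homIterate j).map (M.kerStructureMap.map g))) :
    Epi (M.forgetT.map g) := by
  have key : ∀ k j, j + k = N + 1 → Epi ((M.homIterate j).map (M.forgetT.map g)) := by
    intro k
    induction k with
    | zero =>
      rintro _ rfl
      exact ⟨fun _ _ _ => (M.isZero_homIterate hN _).eq_of_src _ _⟩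
    | succ k ih =>
      intro j hj
      have h₁ := M.shortExact_homIterate j (shortExact_structureComplex hE)
        (hadm.subsingleton_ext_toRight hKE)
      have h₂ := M.shortExact_homIterate j (shortExact_structureComplex hA)
        (hadm.subsingleton_ext_toRight hK)
      let φ := (M.homIterate j).mapShortComplex.map (M.structureComplexMap g)
      have : Epi ((M.homIterate j).mapShortComplex.obj (M.structureComplex E)).g := h₁.epi_g
      have : Epi ((M.homIterate j).mapShortComplex.obj (M.structureComplex A)).g := h₂.epi_g
      have : Epi φ.τ₁ := hg j
      have : Epi φ.τ₃ := ih (j + 1) (by omega)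
      exact ShortComplex.epi_τ₂_of_exact_of_epi φ h₂.exact
  exact key (N + 1) 0 (by omega)

/-- Any embedding of A in an injective will do, since the lifting condition follows from Ext¹(Coind
B, A) = 0. -/
theorem injectiveStep_of_coadmissible {E C : ModuleCat.{u} M.TensorRingᵐᵒᵖ} [Injective E]
    (hA : Function.Surjective (M.structureMap A))
    (hK : gorensteinInjective Y (M.kerStructureMap.obj A)) {f : A ⟶ E} {g : E ⟶ C} {w : f ≫ g = 0}
    (hS : (ShortComplex.mk f g w).ShortExact) : InjectiveStep (Y.map M.coind) A C := by
  refine ⟨E, f, g, w, hS, inferInstance, ?_⟩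
  rintro P ⟨B, hB, ⟨e⟩⟩ φ
  exact hS.exists_lift_of_ext (Ext.subsingleton_congr e (Iso.refl _)
    (subsingleton_ext_coind_of_coadmissible hN hadm hA hK hB)) φ

end coadmissible

/-- Each y · m is killed by M^{⊗ i}, hence is zero by induction. Thus y lies in ker v, where f is
injective. -/
theorem eq_zero_of_act_of_eq_zero {X : ModuleCat.{u} Rᵐᵒᵖ} {f : M.forgetT.obj A ⟶ X}
    (hf : Function.Injective (kerι A ≫ f)) (i : ℕ) {y : M.forgetT.obj A}
    (hy : ∀ t, f (M.act A t y) = 0) (hi : ∀ x, M.act A (of i x) y = 0) : y = 0 := by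
  induction i generalizing y with
  | zero => exact (act_one y).symm.trans (hi (1 : R))
  | succ i ih =>
    obtain ⟨z, rfl⟩ := exists_kerι_eq (y := y) fun m => ih
      (fun t => by rw [← act_mul, hy]) (fun x => by rw [← act_mul, ← of_succ_cons, hi])
    have hz : (kerι A ≫ f) z = 0 := by
      rw [ModuleCat.comp_apply, ← act_one (kerι A z), hy]
    rw [hf (hz.trans (map_zero (kerι A ≫ f).hom).symm), map_zero]

theorem coindLift_injective {N : ℕ} (hN : M.IsNilpotentOf N) {X : ModuleCat.{u} Rᵐᵒᵖ}
    {f : M.forgetT.obj A ⟶ X} (hf : Function.Injective (kerι A ≫ f)) :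
    Function.Injective (coindLift f) := by
  rw [injective_iff_map_eq_zero]
  intro (y : M.forgetT.obj A) hy
  have : Subsingleton (M.pow (N + 1)).carrier := hN
  refine eq_zero_of_act_of_eq_zero hf (N + 1) (y := y) (fun t => ?_) (fun x => ?_)
  · rw [← coindEval_coindLift]
    exact congrArg (fun k => coindEval (X := X) k t) hy
  · rw [Subsingleton.elim x 0, map_zero]
    exact zero_smul _ (show A from y)

/-! ### Steps to the right and to the left inside Ψ. -/

section steps

variable {N : ℕ} (hN : M.IsNilpotentOf N) (hadm : M.IsCoadmissible Y)
  (hA : Function.Surjective (M.structureMap A))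
  (hK : gorensteinInjective Y (M.kerStructureMap.obj A))

include hN hadm hA hK

theorem exists_injectiveStep_right : ∃ C, (Function.Surjective (M.structureMap C) ∧
    gorensteinInjective Y (M.kerStructureMap.obj C)) ∧ InjectiveStep (Y.map M.coind) A C := by
  obtain ⟨Z, hZ, I, α, β, w, hS, hI, -⟩ := hK.exists_step_right
  have hmono : Mono (kerι A) := (ModuleCat.mono_iff_injective _).2 kerι_injective
  let f : M.forgetT.obj A ⟶ I := Injective.factorThru α (kerι A)
  have hf : kerι A ≫ f = α := Injective.comp_factorThru α (kerι A)
  have hinj : Function.Injective (coindLift f) :=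
    coindLift_injective hN (by rw [hf]; exact hS.moduleCat_injective_f)
  have := (ModuleCat.mono_iff_injective _).2 hinj
  let S : ShortComplex (ModuleCat.{u} M.TensorRingᵐᵒᵖ) :=
    ShortComplex.mk (coindLift f) (cokernel.π (coindLift f)) (cokernel.condition _)
  have hSE : S.ShortExact :=
    { exact := ShortComplex.exact_cokernel _
      mono_f := this
      epi_g := inferInstanceAs (Epi (cokernel.π _)) }
  refine ⟨S.X₃, ⟨structureMap_surjective_of_forall fun φ => ?_, ?_⟩,
    injectiveStep_of_coadmissible hN hadm hA hK hSE⟩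
  -- A map from M to the cokernel lifts to Coind(I) because Ext¹(M, UA) = 0, and there it is the
  -- action on an element.
  · obtain ⟨ψ, hψ⟩ := (shortExact_forgetT hSE).exists_lift_of_ext
      (subsingleton_ext_toRight_forgetT hN hadm hA hK) φ
    obtain ⟨y, hy⟩ := exists_act_gen_eq (coind_structureMap_surjective I) ψ
    refine ⟨M.forgetT.map S.g y, fun m => ?_⟩
    rw [← act_map, hy, ← hψ]
    rfl
  -- K turns A → Coind(I) into α : K(A) → I, so K of the cokernel is Z.
  · obtain ⟨e⟩ := (shortExact_kerStructureMap hSE hA).nonempty_iso_X₃ hS (Iso.refl _)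
      (M.kerCoindIso I) (by
        refine Eq.trans ?_ (hf.trans (Category.id_comp α).symm)
        refine ModuleCat.hom_ext (LinearMap.ext fun k => ?_)
        change f (M.act A 1 (kerι A k)) = f (kerι A k)
        rw [act_one])
    exact hZ.congr e.symm

theorem exists_injectiveStep_left (hY : isInjective (ModuleCat.{u} Rᵐᵒᵖ) ≤ Y) :
    ∃ C, (Function.Surjective (M.structureMap C) ∧
      gorensteinInjective Y (M.kerStructureMap.obj C)) ∧ InjectiveStep (Y.map M.coind) C A := by
  obtain ⟨Z, hZ, I, α, β, w, hS, hI, -⟩ := hK.exists_step_left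
  -- By adjunction β is a map triv I → A. It extends to Coind(I) because Ext¹(Coind Hom(M, I), A) =
  -- 0; this uses that the injective I lies in 𝒴.
  obtain ⟨g, hg⟩ := (M.shortExact_coind I).exists_extend_of_ext
    (subsingleton_ext_coind_homRight_of_coadmissible hN hadm hA hK (hY _ hI))
    ((M.trivHomEquiv I A).symm β)
  -- Read through the adjunction, `hg` says that K(g) is β up to K(Coind I) ≅ I.
  have hgβ : M.kerStructureMap.map g = (M.kerCoindIso I).hom ≫ β := by
    rw [← Iso.inv_comp_eq]
    have h := congrArg (M.trivHomEquiv I A) hg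
    rw [Equiv.apply_symm_apply] at h
    exact h
  have hepi : Epi g := by
    have hβ := hS.epi_g
    -- All iterates Hom(M, -)^j β are epi because ker β = Z is Gorenstein injective, so that
    -- co-admissibility applies to it.
    have : Epi (M.forgetT.map g) :=
      epi_homIterate_map hN hadm (coind_structureMap_surjective I)
        ((gorensteinInjective_of_injective Y I).congr (M.kerCoindIso I).symm) hA hK g fun j => by
          have : Epi ((M.homIterate j).map β) :=
            (M.shortExact_homIterate j hS (hadm.subsingleton_ext_toRight hZ)).epi_g
          rw [hgβ, Functor.map_comp]
          exact epi_comp _ _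
    exact (ModuleCat.epi_iff_surjective g).2
      ((ModuleCat.epi_iff_surjective (M.forgetT.map g)).1 this)
  let S : ShortComplex (ModuleCat.{u} M.TensorRingᵐᵒᵖ) :=
    ShortComplex.mk (kernel.ι g) g (kernel.condition g)
  have hSE : S.ShortExact :=
    { exact := ShortComplex.exact_kernel _
      mono_f := inferInstanceAs (Mono (kernel.ι _))
      epi_g := hepi }
  have hSU := shortExact_forgetT hSE
  have hv : Function.Surjective (M.structureMap S.X₁) := by
    refine structureMap_surjective_of_forall fun φ => ?_
    -- Take y in Coind(I) whose action is φ. Then g(y) is killed by M, so it is g(e) for some e in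
    -- K(Coind I); the difference y - e lies in ker g and M acts on it as on y.
    obtain ⟨y, hy⟩ := exists_act_gen_eq (coind_structureMap_surjective I) (φ ≫ M.forgetT.map S.f)
    have hw : ∀ c, M.forgetT.map g (M.forgetT.map S.f c) = 0 :=
      fun c => ConcreteCategory.congr_hom S.zero c
    obtain ⟨k, hk⟩ := exists_kerι_eq (y := M.forgetT.map g y) fun m => by
      rw [← act_map, hy]
      exact hw _
    obtain ⟨e, rfl⟩ : ∃ e, M.kerStructureMap.map g e = k := by
      obtain ⟨i, hi⟩ := hS.moduleCat_surjective_g k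
      refine ⟨(M.kerCoindIso I).inv i, ?_⟩
      rw [hgβ, ModuleCat.comp_apply, Iso.inv_hom_id_apply]
      exact hi
    obtain ⟨c, hc⟩ : ∃ c, M.forgetT.map S.f c = y - kerι (M.coind.obj I) e :=
      (ShortComplex.moduleCat_exact_iff (S.map M.forgetT)).1 hSU.exact _ (by
        change M.forgetT.map g (y - kerι (M.coind.obj I) e) = 0
        rw [map_sub, ← kerι_map_apply, hk, sub_self])
    refine ⟨c, fun m => hSU.moduleCat_injective_f ?_⟩
    change M.forgetT.map S.f (M.act S.X₁ (gen m) c) = M.forgetT.map S.f (φ m)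
    rw [act_map, hc, map_sub, act_gen_kerι, sub_zero]
    exact hy m
  have hKC : gorensteinInjective Y (M.kerStructureMap.obj S.X₁) := by
    obtain ⟨e⟩ := (shortExact_kerStructureMap hSE hv).nonempty_iso_X₁ hS (M.kerCoindIso I)
      (Iso.refl _) ((Category.comp_id _).trans hgβ)
    exact hZ.congr e.symm
  exact ⟨S.X₁, ⟨hv, hKC⟩, injectiveStep_of_coadmissible hN hadm hv hKC hSE⟩

end steps

/-! ### From complete resolutions over T to complete resolutions over R. -/

theorem structureMap_cyclesAt_surjective {I : CochainComplex (ModuleCat.{u} M.TensorRingᵐᵒᵖ) ℤ}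
    (hI : IsCompleteInjectiveResolution (Y.map M.coind) I) (hM : M.IsCocompatible Y) (n : ℤ) :
    Function.Surjective (M.structureMap (cyclesAt I n)) := by
  obtain ⟨n, rfl⟩ : ∃ m, n = m + 1 := ⟨n - 1, by simp⟩
  refine structureMap_surjective_of_forall fun φ => ?_
  let ι := kernel.ι (I.d (n + 1) (n + 1 + 1))
  -- Exactness of Hom(M, U(I)) lifts φ to the preceding term, where v is surjective by injectivity;
  -- the element found there is pushed down to the cycles.
  obtain ⟨x, hx⟩ := (homFrom_acyclic_iff _ _).1 (hM.hom_exact I hI) n (φ ≫ M.forgetT.map ι) (by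
    change (φ ≫ M.forgetT.map ι) ≫ M.forgetT.map (I.d (n + 1) (n + 1 + 1)) = 0
    rw [Category.assoc, ← Functor.map_comp, kernel.condition, Functor.map_zero, comp_zero])
  have hx : x ≫ M.forgetT.map (I.d n (n + 1)) = φ ≫ M.forgetT.map ι := hx
  have := hI.injective n
  obtain ⟨y, hy⟩ := exists_act_gen_eq (structureMap_surjective_of_injective (I.X n)) x
  refine ⟨M.forgetT.map (toCyclesAt I n) y, fun m => ?_⟩
  refine (ModuleCat.mono_iff_injective ι).1 inferInstance ?_
  rw [← act_map, hy]
  have h := ConcreteCategory.congr_hom hx m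
  rw [← toCyclesAt_ι, Functor.map_comp] at h
  exact h

/-- K keeps the cycle sequences exact. Lifting B → K(Zⁿ⁺¹) is lifting triv B → Zⁿ⁺¹, and Hom(triv B,
I) is exact because triv B is the kernel of Coind B → Coind Hom(M, B). -/
theorem injectiveStep_kerStructureMap_cyclesAt
    {I : CochainComplex (ModuleCat.{u} M.TensorRingᵐᵒᵖ) ℤ}
    (hI : IsCompleteInjectiveResolution (Y.map M.coind) I) (hM : M.IsCocompatible Y) (n : ℤ) :
    InjectiveStep Y (M.kerStructureMap.obj (cyclesAt I n))
      (M.kerStructureMap.obj (cyclesAt I (n + 1))) := by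
  have hS := shortExact_kerStructureMap (shortExact_cyclesAt hI.exact n)
    (structureMap_cyclesAt_surjective hI hM n)
  have := hI.injective n
  refine ⟨M.kerStructureMap.obj (I.X n), _, _, _, hS, inferInstance, fun B hB φ => ?_⟩
  have hB' : (homFrom (M.triv.obj B) I).Acyclic :=
    homFrom_acyclic_of_shortExact (M.shortExact_coind B) hI.injective
      (hI.hom_exact _ ⟨B, hB, ⟨Iso.refl _⟩⟩) (hM.coind_hom_exact I hI B hB)
  obtain ⟨ψ, hψ⟩ := lift_toCyclesAt hB' ((M.trivHomEquiv B _).symm φ)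
  refine ⟨M.trivHomEquiv B _ ψ, ?_⟩
  have h := congrArg (M.trivHomEquiv B _) hψ
  rw [Equiv.apply_symm_apply] at h
  exact h

theorem IsCompleteInjectiveResolution.gorensteinInjective_kerStructureMap
    {I : CochainComplex (ModuleCat.{u} M.TensorRingᵐᵒᵖ) ℤ}
    (hI : IsCompleteInjectiveResolution (Y.map M.coind) I) (hM : M.IsCocompatible Y) (n : ℤ) :
    gorensteinInjective Y (M.kerStructureMap.obj (cyclesAt I n)) := by
  refine gorensteinInjective_of_step_of_cycles
    (X := fun K => ∃ n, Nonempty (K ≅ M.kerStructureMap.obj (cyclesAt I n))) ?_ _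
    ⟨n, ⟨Iso.refl _⟩⟩
  rintro K ⟨n, ⟨e⟩⟩
  exact ⟨fun n => M.kerStructureMap.obj (cyclesAt I n), n, ⟨e⟩, fun m =>
    ⟨⟨m, ⟨Iso.refl _⟩⟩, injectiveStep_kerStructureMap_cyclesAt hI hM m⟩⟩

theorem structureMap_surjective_of_iso {B : ModuleCat.{u} M.TensorRingᵐᵒᵖ} (e : A ≅ B)
    (hA : Function.Surjective (M.structureMap A)) : Function.Surjective (M.structureMap B) := by
  refine structureMap_surjective_of_forall fun φ => ?_
  obtain ⟨y, hy⟩ := exists_act_gen_eq hA (φ ≫ M.forgetT.map e.inv)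
  refine ⟨M.forgetT.map e.hom y, fun m => ?_⟩
  rw [← act_map, hy]
  exact e.inv_hom_id_apply (φ m)

end

end RingBimodule

open RingBimodule in
theorem theorem3p5 {R : Type u} [Ring R] (M : RingBimodule R) (N : ℕ) (hN : M.IsNilpotentOf N)
    (Y : ObjectProperty (ModuleCat.{u} Rᵐᵒᵖ)) (hY : isInjective (ModuleCat.{u} Rᵐᵒᵖ) ≤ Y)
    (hcompat : M.IsCocompatible Y) (hadm : M.IsCoadmissible Y) :
    gorensteinInjective (Y.map M.coind) = M.psi (gorensteinInjective Y) := by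
  refine le_antisymm ?_ ?_
  · rintro A ⟨I, hI, ⟨e⟩⟩
    rw [psi_gorensteinInjective_iff]
    exact ⟨structureMap_surjective_of_iso e.symm (structureMap_cyclesAt_surjective hI hcompat 0),
      (IsCompleteInjectiveResolution.gorensteinInjective_kerStructureMap hI hcompat 0).congr
        (M.kerStructureMap.mapIso e.symm)⟩
  -- Ψ of the Gorenstein injectives is closed under steps on both sides.
  · refine gorensteinInjective_of_step (fun A hA => ?_) (fun A hA => ?_)
    · rw [psi_gorensteinInjective_iff] at hA
      obtain ⟨C, hC, h⟩ := exists_injectiveStep_right hN hadm hA.1 hA.2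
      exact ⟨C, (psi_gorensteinInjective_iff C).2 hC, h⟩
    · rw [psi_gorensteinInjective_iff] at hA
      obtain ⟨C, hC, h⟩ := exists_injectiveStep_left hN hadm hA.1 hA.2 hY
      exact ⟨C, (psi_gorensteinInjective_iff C).2 hC, h⟩
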